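/- Let $\mathcal{K}$ be an algebraically closed field of characteristic $0$ with a surjective homomorphism $\exp:(\mathcal{K},+)\to(\mathcal{K}^*,\cdot)$ with infinite kernel, satisfying the following existential closedness axiom (Zilber's pseudoexponential field is such a $\mathcal{K}$): for every $\alpha\ge 1$ and every irreducible, rotund and free Zariski closed subset $V$ of $G_\alpha(\mathcal{K})=\mathcal{K}^\alpha\times(\mathcal{K}^*)^\alpha$, there are infinitely many $\bar x\in\mathcal{K}^\alpha$ with $(\bar x,\exp(\bar x))\in V$. Here $V$ is *free* if it is contained in no set $\{(\bar u,\bar v):\prod_i v_i^{m_i}=b\}$ and in no set $\{(\bar u,\bar v):\sum_i m_iu_i=b\}$ with $b\in\mathcal{K}$ and $(m_1,\dots,m_\alpha)\in\mathbb{Z}^\alpha\setminus\{0\}$. It is *rotund* if $\dim [C](V)\ge r$ for all $1\le r\le\alpha$ and every integer $r\times\alpha$ matrix $C=(c_{ij})$ of rank $r$, where $[C](\bar u,\bar v)=\big((\sum_j c_{ij}u_j)_{i},(\prod_j v_j^{c_{ij}})_{i}\big)\in G_r(\mathcal{K})$ and the dimension is that of the Zariski closure. Let $\mathcal{K}[x]^E$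 be the ring of exponential polynomials in one variable over $\mathcal{K}$: the union of the chain $R_0=\mathcal{K}[x]\subset R_1\subset R_2\subset\cdots$, where $\exp$ is defined on $A_0=\mathcal{K}$ in $R_0$ and on $A_{n+1}=R_n$ in $R_{n+1}$, and $R_{n+1}$ is the group ring over $R_n$ of a $\mathbb{Q}$-linear complement $B_n$ of $A_n$ in $R_n$, with $\exp(a+b)=\exp(a)\cdot[b]$ for $a\in A_n$, $b\in B_n$ ($[b]$ being the group ring basis element at $b$). Elements of $\mathcal{K}[x]^E$ are evaluated at points of $\mathcal{K}$ by the ring homomorphisms that fix $\mathcal{K}$ and commute with $\exp$. Let $m>0$ be a natural number, and suppose that $p\in\mathcal{K}[x]^E$ has exactly $m$ distinct zeros in $\mathcal{K}$. Then there are $a_1,\dots,a_m\in\mathcal{K}$, $n_1,\dots,n_m\in\mathbb{N}$ and $g\in\mathcal{K}[x]^E$ such that, in $\mathcal{K}[x]^E$, $$p=(x-a_1)^{n_1}\cdots(x-a_m)^{n_m}\exp(g).$$ -/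

import Mathlib

noncomputable section

universe u

namespace ZilberExp

/-! ### E-rings and partial E-rings -/

/-- A (total) exponential map on a commutative ring: a homomorphism from the additive group of `R`
to the group of units of `R`. An *E-field* is a field of characteristic zero with such a map. -/
class ERing (R : Type u) [CommRing R] where
  /-- The exponential map, as a group homomorphism. -/
  expHom : Multiplicative R →* Rˣ

/-- The exponential map `R → Rˣ` of an E-ring. -/
def expU {R : Type u} [CommRing R] [ERing R] (r : R) : Rˣ :=
  ERing.expHom (Multiplicative.ofAdd r)

theorem expU_add {R : Type u} [CommRing R] [ERing R] (r s : R) :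
    expU (r + s) = expU r * expU s :=
  map_mul ERing.expHom (Multiplicative.ofAdd r) (Multiplicative.ofAdd s)

/-- A partial E-ring: a `ℚ`-algebra without zero divisors, with a homomorphism from (the additive
group of) a `ℚ`-linear subspace `dom` to the group of units. -/
structure PartialERing where
  carrier : Type u
  [commRing : CommRing carrier]
  [isDomain : IsDomain carrier]
  [algebra : Algebra ℚ carrier]
  /-- The domain of the exponential map. -/
  dom : Submodule ℚ carrier
  /-- The exponential map on its domain. -/
  expHom : Multiplicative dom →* carrierˣ

attribute [instance] PartialERing.commRing PartialERing.isDomain PartialERing.algebra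

namespace PartialERing

variable (R : PartialERing.{u})

/-- A chosen `ℚ`-linear complement of the domain of the exponential map. -/
def compl : Submodule ℚ R.carrier := R.dom.exists_isCompl.choose

theorem isCompl : IsCompl R.dom R.compl := R.dom.exists_isCompl.choose_spec

/-- The ring underlying the extension `R'` of `R`: the group ring over `R` of a `ℚ`-linear
complement `B` of the domain of `exp`. The basis element at `b ∈ B` is `exp b`. -/
abbrev NextCarrier : Type u := AddMonoidAlgebra R.carrier R.compl

/-- The inclusion of `R` in `R'`. -/
def toNext : R.carrier →+* R.NextCarrier := AddMonoidAlgebra.singleZeroRingHom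

theorem toNext_injective : Function.Injective R.toNext := by
  intro x y h
  exact AddMonoidAlgebra.single_right_injective (m := (0 : R.compl)) h

/-- The inclusion of `R` in `R'` as a `ℚ`-linear map. -/
def toNextLin : R.carrier →ₗ[ℚ] R.NextCarrier where
  toFun := R.toNext
  map_add' := map_add _
  map_smul' q x := map_rat_smul R.toNext q x

/-- The exponential map of `R'`, as a homomorphism on all of `R`: if `r = d + b` with `d` in the
domain of the exponential map of `R` and `b` in the complement, then `exp r = exp d * exp b`. -/
def nextExp : Multiplicative R.carrier →* R.NextCarrierˣ :=
  ((Units.map R.toNext.toMonoidHom).comp (R.expHom.comp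
      (AddMonoidHom.toMultiplicative
        (Submodule.projectionOnto R.dom R.compl R.isCompl).toAddMonoidHom))) *
    ((Units.map (AddMonoidAlgebra.of R.carrier R.compl)).comp
      ((toUnits (G := Multiplicative R.compl)).toMonoidHom.comp
      (AddMonoidHom.toMultiplicative
        (Submodule.projectionOnto R.compl R.dom R.isCompl.symm).toAddMonoidHom)))

/-- The partial E-ring extension `R'` of `R` with domain of the exponential map equal to `R`. -/
def next : PartialERing.{u} where
  carrier := R.NextCarrier
  dom := LinearMap.range R.toNextLin
  expHom := R.nextExp.comp (AddMonoidHom.toMultiplicative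
    (LinearEquiv.ofInjective R.toNextLin R.toNext_injective).symm.toLinearMap.toAddMonoidHom)

/-- A ring homomorphism from a partial E-ring to an E-ring that respects the exponential maps. -/
def IsEHom {S : Type u} [CommRing S] [ERing S] (φ : R.carrier →+* S) : Prop :=
  ∀ d : R.dom, φ (R.expHom (Multiplicative.ofAdd d) : R.carrierˣ) = expU (φ d)

/-- The extension to `R'` of a homomorphism `φ` from `R` to an E-ring: the basis element at `b` of
the complement is sent to `exp (φ b)`. -/
def nextLift {S : Type u} [CommRing S] [ERing S] (φ : R.carrier →+* S) : R.NextCarrier →+* S :=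
  AddMonoidAlgebra.liftNCRingHom φ
    ((Units.coeHom S).comp (ERing.expHom.comp
      (AddMonoidHom.toMultiplicative (φ.toAddMonoidHom.comp R.compl.subtype.toAddMonoidHom))))
    (fun _ _ => mul_comm _ _)

/-- The exponential map of `R'` extends that of `R`. -/
theorem nextExp_dom (d : R.dom) :
    R.nextExp (Multiplicative.ofAdd (d : R.carrier)) =
      Units.map R.toNext.toMonoidHom (R.expHom (Multiplicative.ofAdd d)) := by
  have h₁ : Submodule.projectionOnto R.dom R.compl R.isCompl (d : R.carrier) = d :=
    Submodule.projectionOnto_apply_left _ d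
  have h₂ : Submodule.projectionOnto R.compl R.dom R.isCompl.symm (d : R.carrier) = 0 :=
    Submodule.projectionOnto_apply_right _ d
  simp [nextExp, h₁, h₂]

theorem next_expHom (r : R.carrier) (h : R.toNext r ∈ R.next.dom) :
    R.next.expHom (Multiplicative.ofAdd (⟨R.toNext r, h⟩ : R.next.dom)) =
      R.nextExp (Multiplicative.ofAdd r) := by
  have h' : (LinearEquiv.ofInjective R.toNextLin R.toNext_injective).symm ⟨R.toNext r, h⟩ = r :=
    (LinearEquiv.symm_apply_eq _).2 rfl
  exact congrArg (fun x => R.nextExp (Multiplicative.ofAdd x)) h'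

theorem next_nextExp_toNext (r : R.carrier) :
    R.next.nextExp (Multiplicative.ofAdd (R.toNext r : R.next.carrier)) =
      Units.map R.next.toNext.toMonoidHom (R.nextExp (Multiplicative.ofAdd r)) := by
  have h : R.toNext r ∈ R.next.dom := ⟨r, rfl⟩
  rw [← R.next_expHom r h]
  exact R.next.nextExp_dom ⟨R.toNext r, h⟩

@[simp]
theorem nextLift_toNext {S : Type u} [CommRing S] [ERing S] (φ : R.carrier →+* S)
    (r : R.carrier) : R.nextLift φ (R.toNext r) = φ r := by
  refine (AddMonoidAlgebra.liftNCRingHom_single _ _ _ _ _).trans ?_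
  rw [ofAdd_zero, map_one, mul_one]

theorem nextLift_nextExp {S : Type u} [CommRing S] [ERing S] (φ : R.carrier →+* S)
    (hφ : R.IsEHom φ) (r : R.carrier) :
    R.nextLift φ (R.nextExp (Multiplicative.ofAdd r) : R.NextCarrierˣ) = expU (φ r) := by
  have h := Submodule.projection_add_projection_eq_self R.isCompl r
  rw [← Submodule.coe_projectionOnto_apply, ← Submodule.coe_projectionOnto_apply] at h
  have h₁ := hφ (Submodule.projectionOnto R.dom R.compl R.isCompl r)
  have h₂ : R.nextLift φ (AddMonoidAlgebra.single
      (Submodule.projectionOnto R.compl R.dom R.isCompl.symm r) 1) =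
      expU (φ (Submodule.projectionOnto R.compl R.dom R.isCompl.symm r)) := by
    refine (AddMonoidAlgebra.liftNCRingHom_single _ _ _ _ _).trans ?_
    rw [map_one, one_mul]; rfl
  have h₃ : (R.nextExp (Multiplicative.ofAdd r) : R.NextCarrier) =
      R.toNext (R.expHom (Multiplicative.ofAdd
        (Submodule.projectionOnto R.dom R.compl R.isCompl r)) : R.carrierˣ) *
      AddMonoidAlgebra.single (Submodule.projectionOnto R.compl R.dom R.isCompl.symm r) 1 := rfl
  rw [h₃, map_mul, nextLift_toNext, h₁, h₂, ← Units.val_mul, ← expU_add, ← map_add, h]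

theorem isEHom_nextLift {S : Type u} [CommRing S] [ERing S] (φ : R.carrier →+* S)
    (hφ : R.IsEHom φ) : R.next.IsEHom (R.nextLift φ) := by
  rintro ⟨_, r, rfl⟩
  have h := R.nextLift_nextExp φ hφ r
  rw [← R.next_expHom r ⟨r, rfl⟩] at h
  exact h.trans (congrArg (fun x => (expU x : S)) (R.nextLift_toNext φ r).symm)

end PartialERing

/-! ### The ring of exponential polynomials in one variable -/

section ExpPoly

variable (K : Type u) [Field K] [CharZero K] [ERing K]

/-- The constants of `K[X]` as a `ℚ`-linear map. -/
def constLin : K →ₗ[ℚ] Polynomial K where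
  toFun := Polynomial.C
  map_add' _ _ := Polynomial.C_add
  map_smul' q x := (Polynomial.smul_C q x).symm

/-- `K[X]` as a partial E-ring: the exponential map is defined exactly on the constants. -/
def baseERing : PartialERing.{u} where
  carrier := Polynomial K
  dom := LinearMap.range (constLin K)
  expHom := ((Units.map (Polynomial.C : K →+* Polynomial K).toMonoidHom).comp
    ERing.expHom).comp (AddMonoidHom.toMultiplicative
      (LinearEquiv.ofInjective (constLin K) Polynomial.C_injective).symm.toLinearMap.toAddMonoidHom)

theorem baseERing_expHom (c : K) (h : constLin K c ∈ (baseERing K).dom) :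
    (baseERing K).expHom (Multiplicative.ofAdd (⟨constLin K c, h⟩ : (baseERing K).dom)) =
      Units.map (Polynomial.C : K →+* Polynomial K).toMonoidHom (expU c) := by
  have h' : (LinearEquiv.ofInjective (constLin K) Polynomial.C_injective).symm
      ⟨constLin K c, h⟩ = c := (LinearEquiv.symm_apply_eq _).2 rfl
  exact congrArg (fun x => Units.map (Polynomial.C : K →+* Polynomial K).toMonoidHom (expU x)) h'

/-- The chain of partial E-rings `R₀ = K[X]`, `Rₙ₊₁ = Rₙ'`. -/
def chain (n : ℕ) : PartialERing.{u} :=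
  Nat.rec (baseERing K) (fun _ R => R.next) n

/-- The inclusion of `Rₙ` in `Rₙ₊₁`. -/
def chainStep (n : ℕ) : (chain K n).carrier →+* (chain K (n + 1)).carrier := (chain K n).toNext

/-- The inclusion of `Rₘ` in `Rₙ` for `m ≤ n`. -/
def chainMap (m n : ℕ) (h : m ≤ n) : (chain K m).carrier →+* (chain K n).carrier :=
  Nat.leRecOn h (C := fun k => (chain K m).carrier →+* (chain K k).carrier)
    (fun {k} g => (chainStep K k).comp g) (RingHom.id _)

theorem chainMap_self (m : ℕ) : chainMap K m m le_rfl = RingHom.id _ :=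
  Nat.leRecOn_self (C := fun k => (chain K m).carrier →+* (chain K k).carrier) _

theorem chainMap_succ (m n : ℕ) (h : m ≤ n) :
    chainMap K m (n + 1) (h.trans n.le_succ) = (chainStep K n).comp (chainMap K m n h) :=
  Nat.leRecOn_succ (C := fun k => (chain K m).carrier →+* (chain K k).carrier) h _

theorem chainMap_comp (l m n : ℕ) (h : l ≤ m) (h' : m ≤ n) :
    (chainMap K m n h').comp (chainMap K l m h) = chainMap K l n (h.trans h') := by
  induction n, h' using Nat.le_induction with
  | base => rw [chainMap_self, RingHom.id_comp]
  | succ n hmn ih => rw [chainMap_succ K m n hmn, RingHom.comp_assoc, ih, chainMap_succ]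

instance chainMap_directedSystem :
    DirectedSystem (fun n => (chain K n).carrier) (chainMap K · · ·) where
  map_self := fun m x => by rw [chainMap_self]; rfl
  map_map := fun _ _ _ h h' x => by rw [← chainMap_comp K _ _ _ h h']; rfl

/-- The ring `K[x]^E` of exponential polynomials in one variable: the union of the chain. -/
def ExpPoly : Type u := DirectLimit (fun n => (chain K n).carrier) (chainMap K)

instance : CommRing (ExpPoly K) :=
  inferInstanceAs (CommRing (DirectLimit (fun n => (chain K n).carrier) (chainMap K)))

namespace ExpPoly

/-- The inclusion of `Rₙ` in `K[x]^E`. -/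
def of (n : ℕ) : (chain K n).carrier →+* ExpPoly K where
  toFun r := (⟦⟨n, r⟩⟧ : DirectLimit (fun n => (chain K n).carrier) (chainMap K))
  map_one' := (DirectLimit.one_def n).symm
  map_zero' := (DirectLimit.zero_def n).symm
  map_mul' x y := (DirectLimit.mul_def (f := chainMap K) n x y).symm
  map_add' x y := (DirectLimit.add_def (f := chainMap K) n x y).symm

theorem of_chainStep (n : ℕ) (r : (chain K n).carrier) :
    of K (n + 1) (chainStep K n r) = of K n r := by
  have h : chainStep K n r = chainMap K n (n + 1) n.le_succ r := by
    rw [chainMap_succ K n n le_rfl, chainMap_self]; rfl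
  rw [h]
  exact DirectLimit.mk_apply (f := chainMap K) n (n + 1) r n.le_succ

/-- The exponential of an element of `Rₙ`, as an element of `K[x]^E`. -/
def expLevel (n : ℕ) : Multiplicative (chain K n).carrier →* (ExpPoly K)ˣ :=
  (Units.map (of K (n + 1)).toMonoidHom).comp (chain K n).nextExp

theorem expLevel_chainStep (n : ℕ) (r : (chain K n).carrier) :
    expLevel K (n + 1) (Multiplicative.ofAdd (chainStep K n r)) =
      expLevel K n (Multiplicative.ofAdd r) := by
  refine (congrArg (Units.map (of K (n + 2)).toMonoidHom)
    ((chain K n).next_nextExp_toNext r)).trans ?_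
  exact Units.ext (of_chainStep K (n + 1) _)

theorem expLevel_chainMap (m n : ℕ) (h : m ≤ n) (r : (chain K m).carrier) :
    expLevel K m (Multiplicative.ofAdd r) =
      expLevel K n (Multiplicative.ofAdd (chainMap K m n h r)) := by
  induction n, h using Nat.le_induction with
  | base => rw [chainMap_self]; rfl
  | succ n hmn ih => rw [chainMap_succ K m n hmn, ih, RingHom.comp_apply, expLevel_chainStep]

/-- The exponential map of `K[x]^E`. -/
def exp : ExpPoly K → (ExpPoly K)ˣ :=
  DirectLimit.lift (chainMap K) (fun n r => expLevel K n (Multiplicative.ofAdd r))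
    (expLevel_chainMap K)

theorem exp_of (n : ℕ) (r : (chain K n).carrier) :
    exp K (of K n r) = expLevel K n (Multiplicative.ofAdd r) := rfl

theorem exists_of₂ (f g : ExpPoly K) : ∃ n r s, of K n r = f ∧ of K n s = g := by
  obtain ⟨n, r, s, h, h'⟩ := DirectLimit.exists_eq_mk₂ (chainMap K) f g
  exact ⟨n, r, s, h.symm, h'.symm⟩

instance : ERing (ExpPoly K) where
  expHom :=
    { toFun := fun r => exp K r.toAdd
      map_one' := by
        have h : exp K 0 = 1 := by
          rw [← map_zero (of K 0), exp_of, ofAdd_zero, map_one]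
        exact h
      map_mul' := fun x y => by
        obtain ⟨n, r, s, hr, hs⟩ := exists_of₂ K x.toAdd y.toAdd
        rw [toAdd_mul, ← hr, ← hs, ← map_add, exp_of, exp_of, exp_of, ofAdd_add, map_mul] }

/-- The constant exponential polynomial `c`. -/
def C : K →+* ExpPoly K := (of K 0).comp (Polynomial.C : K →+* Polynomial K)

/-- The indeterminate `x`. -/
def X : ExpPoly K := of K 0 (Polynomial.X : Polynomial K)

variable {K}

/-- Evaluation of elements of `Rₙ` at `a`. -/
def evalLevel (a : K) (n : ℕ) : (chain K n).carrier →+* K :=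
  Nat.rec (motive := fun n => (chain K n).carrier →+* K)
    (Polynomial.evalRingHom a) (fun n φ => (chain K n).nextLift φ) n

theorem isEHom_evalLevel (a : K) (n : ℕ) : (chain K n).IsEHom (evalLevel a n) := by
  induction n with
  | zero =>
    rintro ⟨_, c, rfl⟩
    have h₁ := congrArg (fun u : (Polynomial K)ˣ => Polynomial.evalRingHom a (u : Polynomial K))
      (baseERing_expHom K c ⟨c, rfl⟩)
    refine h₁.trans (Polynomial.eval_C.trans ?_)
    exact congrArg (fun x => (expU x : K)) (Polynomial.eval_C (a := c) (x := a)).symm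
  | succ n ih => exact (chain K n).isEHom_nextLift _ ih

theorem evalLevel_chainMap (a : K) (m n : ℕ) (h : m ≤ n) (r : (chain K m).carrier) :
    evalLevel a m r = evalLevel a n (chainMap K m n h r) := by
  induction n, h using Nat.le_induction with
  | base => rw [chainMap_self]; rfl
  | succ n hmn ih =>
    rw [chainMap_succ K m n hmn, ih]
    exact ((chain K n).nextLift_toNext (evalLevel a n) _).symm

/-- Evaluation of an exponential polynomial at a point `a` of `K`. -/
def eval (a : K) : ExpPoly K →+* K where
  toFun := DirectLimit.lift (chainMap K) (fun n r => evalLevel a n r) (evalLevel_chainMap a)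
  map_one' := by
    rw [← map_one (of K 0)]
    exact map_one (evalLevel a 0)
  map_zero' := by
    rw [← map_zero (of K 0)]
    exact map_zero (evalLevel a 0)
  map_mul' f g := by
    obtain ⟨n, r, s, rfl, rfl⟩ := exists_of₂ K f g
    rw [← map_mul]
    exact map_mul (evalLevel a n) r s
  map_add' f g := by
    obtain ⟨n, r, s, rfl, rfl⟩ := exists_of₂ K f g
    rw [← map_add]
    exact map_add (evalLevel a n) r s

theorem eval_of (a : K) (n : ℕ) (r : (chain K n).carrier) :
    eval a (of K n r) = evalLevel a n r := rfl

theorem eval_C (a c : K) : eval a (C K c) = c := Polynomial.eval_C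

theorem eval_X (a : K) : eval a (X K) = a := Polynomial.eval_X

theorem eval_expU (a : K) (f : ExpPoly K) : eval a (expU f : (ExpPoly K)ˣ) = expU (eval a f) := by
  obtain ⟨n, r, -, rfl, -⟩ := exists_of₂ K f f
  exact (chain K n).nextLift_nextExp _ (isEHom_evalLevel a n) r

theorem expU_C (c : K) : (expU (C K c) : ExpPoly K) = C K (expU c : K) := by
  have h := (baseERing K).nextExp_dom ⟨constLin K c, c, rfl⟩
  have h' := congrArg (fun u : (baseERing K).NextCarrierˣ =>
    of K 1 (u : (baseERing K).NextCarrier))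
    (h.trans (congrArg (Units.map (baseERing K).toNext.toMonoidHom)
      (baseERing_expHom K c ⟨c, rfl⟩)))
  exact h'.trans (of_chainStep K 0 _)

theorem of_injective (n : ℕ) : Function.Injective (of K n) := by
  refine DirectLimit.mk_injective (chainMap K) (fun i j h => ?_) n
  induction j, h using Nat.le_induction with
  | base => rw [chainMap_self]; exact Function.injective_id
  | succ j hij ih =>
    rw [chainMap_succ K i j hij]
    exact (chain K j).toNext_injective.comp ih

instance : IsDomain (ExpPoly K) :=
  have : Nontrivial (ExpPoly K) := (of_injective (K := K) 0).nontrivial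
  have : NoZeroDivisors (ExpPoly K) := ⟨fun {f g} h => by
    obtain ⟨n, r, s, rfl, rfl⟩ := exists_of₂ K f g
    rw [← map_mul, map_eq_zero_iff _ (of_injective n), mul_eq_zero] at h
    exact h.imp (fun h => by rw [h, map_zero]) (fun h => by rw [h, map_zero])⟩
  NoZeroDivisors.to_isDomain _

end ExpPoly
end ExpPoly

/-! ### Varieties in `G_α(K) = K^α × (K^*)^α` -/

section Varieties

variable {K : Type u} [Field K]

/-- The group `G_α(K) = K^α × (K^*)^α`. -/
abbrev GPoint (K : Type u) [Field K] (α : ℕ) : Type u := (Fin α → K) × (Fin α → Kˣ)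

/-- The `2α` coordinates of a point of `G_α(K)`. -/
def coords {α : ℕ} (g : GPoint K α) : Fin α ⊕ Fin α → K :=
  Sum.elim g.1 (fun i => (g.2 i : K))

/-- A variety: a (possibly reducible) Zariski closed subset of `G_α(K)`. -/
def IsVariety {α : ℕ} (V : Set (GPoint K α)) : Prop :=
  ∃ S : Set (MvPolynomial (Fin α ⊕ Fin α) K),
    V = {g | ∀ f ∈ S, MvPolynomial.eval (coords g) f = 0}

/-- Irreducibility in the Zariski topology of `G_α(K)`. -/
def IsIrreducibleVariety {α : ℕ} (V : Set (GPoint K α)) : Prop :=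
  IsVariety V ∧ V.Nonempty ∧ ∀ W₁ W₂ : Set (GPoint K α), IsVariety W₁ → IsVariety W₂ →
    V ⊆ W₁ ∪ W₂ → V ⊆ W₁ ∨ V ⊆ W₂

/-- The dimension of (the Zariski closure of) a subset `S` of `G_α(K)`: the transcendence degree
over `K` of the ring of polynomial functions on `S`. -/
def dim {α : ℕ} (S : Set (GPoint K α)) : Cardinal.{u} :=
  Algebra.trdeg K (MvPolynomial (Fin α ⊕ Fin α) K ⧸ MvPolynomial.vanishingIdeal K (coords '' S))

/-- The map `[C] : G_α(K) → G_r(K)` given by an `r × α` integer matrix `C`. -/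
def matMap {r α : ℕ} (C : Matrix (Fin r) (Fin α) ℤ) (g : GPoint K α) : GPoint K r :=
  (fun i => ∑ j, (C i j : K) * g.1 j, fun i => ∏ j, g.2 j ^ C i j)

/-- Rotundity of `V`: `dim [C](V) ≥ r` for every `r × α` integer matrix `C` of rank `r ≥ 1`. -/
def IsRotund {α : ℕ} (V : Set (GPoint K α)) : Prop :=
  ∀ (r : ℕ) (C : Matrix (Fin r) (Fin α) ℤ), 1 ≤ r → r ≤ α → C.rank = r →
    (r : Cardinal.{u}) ≤ dim (matMap C '' V)

/-- Freeness of `V`: it satisfies no nontrivial equation `∏ vᵢ ^ mᵢ = b` or `∑ mᵢ uᵢ = b`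
with integers `mᵢ` and `b ∈ K`. -/
def IsFree {α : ℕ} (V : Set (GPoint K α)) : Prop :=
  ¬ ∃ (m : Fin α → ℤ) (b : K), m ≠ 0 ∧
    (V ⊆ {g | ((∏ i, g.2 i ^ m i : Kˣ) : K) = b} ∨ V ⊆ {g | ∑ i, (m i : K) * g.1 i = b})

end Varieties

/-- Existential closedness: every irreducible, rotund and free variety `V ⊆ G_α(K)` with `α ≥ 1`
has infinitely many points of the form `(x, exp x)`. -/
def IsExistentiallyClosed (K : Type u) [Field K] [ERing K] : Prop :=
  ∀ (α : ℕ) (V : Set (GPoint K α)), 1 ≤ α → IsIrreducibleVariety V → IsRotund V → IsFree V →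
    {x : Fin α → K | ((x, fun i => expU (x i)) : GPoint K α) ∈ V}.Infinite

end ZilberExp

end

/-!
Every exponential polynomial is a fraction `P / Q` of polynomials in `x, exp f₀, …, exp fₙ₋₁`, where
`Q` is a unit, for some *tower* `f₀, …, fₙ₋₁` (`IsTower`): `f₀` is a multiple of `x`, each `fⱼ` is
such a fraction in `x` and the previous exponentials, and the `fⱼ` are `ℚ`-linearly independent
modulo constants (`exists_isTower_mem_level`). So the theorem reduces to the statement that a
polynomial `P` in `x, v₀, …, vₙ₋₁` with finitely many zeros on the graph `vⱼ = exp fⱼ` is a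
polynomial in `x` times a monomial in the `vⱼ` (`IsTower.finiteZerosSplit`). The denominator `Q` has
no zeros, so it is a constant times a monomial; a polynomial in `x` splits into linear factors; and
constants and monomials are exponentials.

That statement is proved by induction on `n`. Removing a power of the last variable, one may assume
that `P` is not divisible by it. If `P` still involves the last variable, it has infinitely many
zeros (`IsTower.infinite_zeros`). To see this, take `x, v₀, …, vₙ₋₂` algebraically independent over
`K`, let `vₙ₋₁ ≠ 0` be a root of `P` in an algebraically closed extension `E`, let `uⱼ` be the value
of `fⱼ` at this generic point, and let `V` be the Zariski locus of `(u, v)` over `K`. A point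
`(a, exp a)` of `V` satisfies `aⱼ = fⱼ(x₀)` for `x₀` proportional to `a₀`, and `x₀` is a zero of `P`.
So it suffices that `V` satisfies the hypotheses of existential closedness.

* `V` is irreducible, being the locus of a point with coordinates in a field. Everything about `V`
  is read off from the generic point, since the `K`-valued points of its coordinate ring separate the
  elements of that ring.
* `V` is rotund (`isRotund_locus`). Let `C` have rank `r`, let `S` be the set of coordinates of
  `[C](u, v)`, and let `w` be a nonzero vector in the row space of `C` whose last nonzero entry is as
  early as possible, at `l`. The element `∑ wⱼ uⱼ` is transcendental, it is algebraic over `S`, and it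
  is a rational function of the `l + 1` elements `Y = {x, v₀, …, vₗ₋₁}`. In the matroid of algebraic
  independence, `S ∪ Y` therefore has rank at most `rk S + l`. By the choice of `l`, the rows of `C`
  and the first `l` unit vectors are independent, so `n - r - l` of the `vⱼ` added to `S ∪ Y` span
  everything, and `n ≤ rk S + l + (n - r - l)`.
* No nontrivial integral combination of the `uⱼ` is constant, so the only obstruction to freeness is
  a relation `∏ vⱼ ^ mⱼ = b`. In that case `P` vanishes wherever `exp h = β`, for a nonconstant `ℚ`-linear
  combination `h` of the tower and a constant `β` (`IsTower.infinite_zeros_of_prod_eq`). There are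
  infinitely many logarithms `c` of `β`, because the kernel is infinite, and `h` omits at most one
  value: by the induction hypothesis, if `h - c` and `h - c'` have no zeros, their numerators and
  their common denominator are monomials up to constants, which forces `h` to be constant.
-/

noncomputable section
universe u
namespace ZilberExp
open MvPolynomial

/-! ### Fractions with unit denominator -/

section UnitFrac

variable {σ τ S S' : Type*} (K : Type*) [Field K] [CommRing S] [Algebra K S] [CommRing S']
  [Algebra K S']

/-- The elements of `S` that are quotients `P(z) / Q(z)` of polynomial expressions in the family
`z`, where the denominator `Q(z)` is a unit of `S`. -/
def unitFrac (z : σ → S) : Subalgebra K S where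
  carrier := {s | ∃ P Q : MvPolynomial σ K, IsUnit (aeval z Q) ∧ aeval z Q * s = aeval z P}
  mul_mem' := by
    rintro a b ⟨P, Q, hQ, h⟩ ⟨P', Q', hQ', h'⟩
    refine ⟨P * P', Q * Q', by rw [map_mul]; exact hQ.mul hQ', ?_⟩
    rw [map_mul, map_mul, ← h, ← h']; ring
  add_mem' := by
    rintro a b ⟨P, Q, hQ, h⟩ ⟨P', Q', hQ', h'⟩
    refine ⟨P * Q' + P' * Q, Q * Q', by rw [map_mul]; exact hQ.mul hQ', ?_⟩
    rw [map_mul, map_add, map_mul, map_mul, ← h, ← h']; ring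
  algebraMap_mem' c := ⟨C c, 1, by simp, by simp⟩

variable {K}

theorem apply_mem_unitFrac (z : σ → S) (i : σ) : z i ∈ unitFrac K z :=
  ⟨X i, 1, by simp, by simp⟩

theorem units_inv_mem_unitFrac {z : σ → S} {s : Sˣ} (hs : (s : S) ∈ unitFrac K z) :
    ((s⁻¹ : Sˣ) : S) ∈ unitFrac K z := by
  obtain ⟨P, Q, hQ, h⟩ := hs
  refine ⟨Q, P, h ▸ hQ.mul s.isUnit, ?_⟩
  rw [← h, mul_assoc, Units.mul_inv, mul_one]

theorem units_zpow_mem_unitFrac {z : σ → S} {s : Sˣ} (hs : (s : S) ∈ unitFrac K z) (n : ℤ) :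
    ((s ^ n : Sˣ) : S) ∈ unitFrac K z := by
  cases n with
  | ofNat n => simpa using pow_mem hs n
  | negSucc n =>
    rw [zpow_negSucc]
    exact units_inv_mem_unitFrac (by simpa using pow_mem hs (n + 1))

theorem units_prod_zpow_mem_unitFrac {ι : Type*} {z : σ → S} (t : Finset ι) {s : ι → Sˣ}
    (hs : ∀ i ∈ t, (s i : S) ∈ unitFrac K z) (n : ι → ℤ) :
    ((∏ i ∈ t, s i ^ n i : Sˣ) : S) ∈ unitFrac K z := by
  rw [Units.coe_prod]
  exact prod_mem fun i hi => units_zpow_mem_unitFrac (hs i hi) _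

theorem aeval_mem_of_forall_mem {z : σ → S} {A : Subalgebra K S} (h : ∀ i, z i ∈ A)
    (P : MvPolynomial σ K) : aeval z P ∈ A := by
  induction P using MvPolynomial.induction_on with
  | C a => rw [aeval_C]; exact A.algebraMap_mem a
  | add p q hp hq => rw [map_add]; exact add_mem hp hq
  | mul_X p i hp => rw [map_mul, aeval_X]; exact mul_mem hp (h i)

theorem unitFrac_le {z : σ → S} {z' : τ → S} (h : ∀ i, z i ∈ unitFrac K z') :
    unitFrac K z ≤ unitFrac K z' := by
  rintro s ⟨P, Q, ⟨q, hq⟩, hs⟩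
  have hqm : ((q⁻¹ : Sˣ) : S) ∈ unitFrac K z' :=
    units_inv_mem_unitFrac (hq ▸ aeval_mem_of_forall_mem h Q)
  have : s = ((q⁻¹ : Sˣ) : S) * aeval z P := by
    rw [← hs, ← hq, ← mul_assoc, Units.inv_mul, one_mul]
  exact this ▸ mul_mem hqm (aeval_mem_of_forall_mem h P)

theorem map_mem_unitFrac (φ : S →ₐ[K] S') {z : σ → S} {s : S} (hs : s ∈ unitFrac K z) :
    φ s ∈ unitFrac K (fun i => φ (z i)) := by
  obtain ⟨P, Q, hQ, h⟩ := hs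
  have key (P : MvPolynomial σ K) : aeval (fun i => φ (z i)) P = φ (aeval z P) :=
    (comp_aeval_apply z φ P).symm
  exact ⟨P, Q, by rw [key]; exact hQ.map φ, by rw [key, key, ← map_mul, h]⟩

/-! Membership of a pair `(e, s)` in the fractions in the pairs `(y i, z i)` says that `e` and `s`
are values of the same rational function, at the points `y` and `z`. -/

variable {E : Type*} [Field E] [Algebra K E]

theorem aeval_prodMk (y : σ → E) (z : σ → S) (P : MvPolynomial σ K) :
    aeval (fun i => (y i, z i)) P = (aeval y P, aeval z P) :=
  Prod.ext (comp_aeval_apply (fun i => (y i, z i)) (AlgHom.fst K E S) P)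
    (comp_aeval_apply (fun i => (y i, z i)) (AlgHom.snd K E S) P)

/-- A rational function with unit denominator at `z` can be evaluated at any algebraically
independent family `y`. -/
theorem exists_prodMk_mem_unitFrac [Nontrivial S] {y : σ → E} (hy : AlgebraicIndependent K y)
    {z : σ → S} {s : S} (hs : s ∈ unitFrac K z) :
    ∃ e : E, (e, s) ∈ unitFrac K (fun i => (y i, z i)) := by
  obtain ⟨P, Q, hQ, h⟩ := hs
  have hQy : aeval y Q ≠ 0 := fun h0 => by
    rw [hy.eq_zero_of_aeval_eq_zero Q h0, map_zero] at hQ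
    exact not_isUnit_zero hQ
  refine ⟨aeval y P / aeval y Q, P, Q, ?_, ?_⟩
  · rw [aeval_prodMk, Prod.isUnit_iff]
    exact ⟨isUnit_iff_ne_zero.2 hQy, hQ⟩
  · rw [aeval_prodMk, aeval_prodMk, Prod.mk_mul_mk, h, mul_div_cancel₀ _ hQy]

/-- A rational function that is constant at an algebraically independent family has the same
constant value everywhere. -/
theorem eq_algebraMap_of_prodMk_mem_unitFrac {y : σ → E} (hy : AlgebraicIndependent K y)
    {z : σ → S} {s : S} {c : K} (h : (algebraMap K E c, s) ∈ unitFrac K (fun i => (y i, z i))) :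
    s = algebraMap K S c := by
  obtain ⟨P, Q, hQ, h⟩ := h
  rw [aeval_prodMk, aeval_prodMk, Prod.mk_mul_mk, Prod.mk.injEq] at h
  rw [aeval_prodMk, Prod.isUnit_iff] at hQ
  have hPQ : P = Q * C c := hy (by rw [map_mul, aeval_C, ← h.1])
  rw [hPQ, map_mul, aeval_C] at h
  exact hQ.2.mul_left_cancel (by simpa using h.2)

end UnitFrac

/-! ### The locus of a generic point -/

section Locus

variable {K E : Type u} [Field K] [Field E] [Algebra K E]

/-- The Zariski locus over `K` of the point `(u, v)` of `G_n(E)`, where `E` is an extension field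
of `K`. -/
def locus (K : Type u) [Field K] [Algebra K E] {n : ℕ} (u : Fin n → E) (v : Fin n → Eˣ) :
    Set (GPoint K n) :=
  {g | ∀ f : MvPolynomial (Fin n ⊕ Fin n) K,
    aeval (Sum.elim u fun i => (v i : E)) f = 0 → MvPolynomial.eval (coords g) f = 0}

/-- Zariski's lemma in the form: the homomorphisms to an algebraically closed field `K` separate
the elements of a finitely generated `K`-subalgebra of an extension field. -/
theorem exists_algHom_ne_zero [IsAlgClosed K] {s : Set E} (hs : s.Finite)
    {r : Algebra.adjoin K s} (hr : r ≠ 0) : ∃ φ : Algebra.adjoin K s →ₐ[K] K, φ r ≠ 0 := by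
  -- a maximal ideal of the algebra with `r⁻¹` adjoined does not contain `r`
  let A := Algebra.adjoin K (insert (r : E)⁻¹ s)
  have hft : Algebra.FiniteType K A :=
    (Subalgebra.fg_iff_finiteType _).1 (Subalgebra.fg_def.2 ⟨_, hs.insert _, rfl⟩)
  obtain ⟨I, hI⟩ := Ideal.exists_maximal A
  let := Ideal.Quotient.field I
  have := finite_of_finite_type_of_isJacobsonRing K (A ⧸ I)
  let e : K ≃ₐ[K] A ⧸ I := AlgEquiv.ofBijective (Algebra.ofId K (A ⧸ I))
    IsAlgClosed.algebraMap_bijective_of_isIntegral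
  let ι : Algebra.adjoin K s →ₐ[K] A :=
    Subalgebra.inclusion (Algebra.adjoin_mono (Set.subset_insert _ _))
  refine ⟨(e.symm.toAlgHom.comp (Ideal.Quotient.mkₐ K I)).comp ι, fun h => ?_⟩
  have h1 : ι r * ⟨(r : E)⁻¹, Algebra.subset_adjoin (Set.mem_insert _ _)⟩ = 1 :=
    Subtype.ext (mul_inv_cancel₀ (fun h0 => hr (Subtype.ext h0)))
  have h2 := congrArg (e.symm.toAlgHom.comp (Ideal.Quotient.mkₐ K I)) h1
  rw [map_mul, map_one] at h2
  rw [AlgHom.comp_apply] at h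
  rw [h, zero_mul] at h2
  exact zero_ne_one h2

variable {n : ℕ} (u : Fin n → E) (v : Fin n → Eˣ)

/-- The coordinate ring of the locus of `(u, v)` as a closed subset of `G_n`. -/
abbrev coordRing (K : Type u) [Field K] [Algebra K E] {n : ℕ} (u : Fin n → E) (v : Fin n → Eˣ) :
    Subalgebra K E :=
  Algebra.adjoin K (Set.range u ∪ (Set.range (fun i => (v i : E)) ∪
    Set.range (fun i => ((v i)⁻¹ : E))))

/-- The additive coordinate functions in the coordinate ring. -/
def coordU (i : Fin n) : coordRing K u v :=
  ⟨u i, Algebra.subset_adjoin (Or.inl ⟨i, rfl⟩)⟩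

/-- The multiplicative coordinate functions, as units of the coordinate ring. -/
def coordV (i : Fin n) : (coordRing K u v)ˣ where
  val := ⟨v i, Algebra.subset_adjoin (Or.inr (Or.inl ⟨i, rfl⟩))⟩
  inv := ⟨(v i : E)⁻¹, Algebra.subset_adjoin (Or.inr (Or.inr ⟨i, rfl⟩))⟩
  val_inv := Subtype.ext (mul_inv_cancel₀ (v i).ne_zero)
  inv_val := Subtype.ext (inv_mul_cancel₀ (v i).ne_zero)

/-- All the coordinate functions in the coordinate ring. -/
def coordFun : Fin n ⊕ Fin n → coordRing K u v :=
  Sum.elim (coordU u v) (fun i => (coordV (K := K) u v i).val)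

variable {u v}

theorem val_coordFun (i : Fin n ⊕ Fin n) :
    (coordRing K u v).val (coordFun u v i) = Sum.elim u (fun i => (v i : E)) i := by
  rcases i with i | i <;> rfl

theorem val_aeval_coordFun (f : MvPolynomial (Fin n ⊕ Fin n) K) :
    (coordRing K u v).val (aeval (coordFun (K := K) u v) f) =
      aeval (Sum.elim u fun i => (v i : E)) f := by
  rw [comp_aeval_apply]
  simp only [val_coordFun]

theorem map_val_coordV (i : Fin n) :
    Units.map ((coordRing K u v).val : coordRing K u v →* E) (coordV u v i) = v i :=
  Units.ext rfl

/-- The point of `G_n(K)` given by a `K`-valued point of the coordinate ring. -/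
def pointOfHom (φ : coordRing K u v →ₐ[K] K) : GPoint K n :=
  (fun i => φ (coordU u v i), fun i => Units.map (φ : coordRing K u v →* K) (coordV u v i))

theorem coords_pointOfHom (φ : coordRing K u v →ₐ[K] K) :
    coords (pointOfHom φ) = fun i => φ (coordFun u v i) := by
  ext (i | i) <;> rfl

theorem pointOfHom_mem_locus (φ : coordRing K u v →ₐ[K] K) : pointOfHom φ ∈ locus K u v := by
  intro f hf
  rw [coords_pointOfHom]
  have h : aeval (coordFun (K := K) u v) f = 0 := Subtype.ext ((val_aeval_coordFun f).trans hf)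
  have h2 := comp_aeval_apply (coordFun (K := K) u v) φ f
  rw [h, map_zero] at h2
  exact h2.symm

theorem eq_zero_of_forall_algHom [IsAlgClosed K] {r : coordRing K u v}
    (h : ∀ φ : coordRing K u v →ₐ[K] K, φ r = 0) : r = 0 := by
  by_contra hr
  obtain ⟨φ, hφ⟩ := exists_algHom_ne_zero
    ((Set.finite_range _).union ((Set.finite_range _).union (Set.finite_range _))) hr
  exact hφ (h φ)

theorem aeval_eq_zero_of_forall_mem_locus [IsAlgClosed K] {f : MvPolynomial (Fin n ⊕ Fin n) K}
    (h : ∀ g ∈ locus K u v, MvPolynomial.eval (coords g) f = 0) :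
    aeval (Sum.elim u fun i => (v i : E)) f = 0 := by
  have h0 : aeval (coordFun (K := K) u v) f = 0 := by
    refine eq_zero_of_forall_algHom fun φ => ?_
    rw [comp_aeval_apply, ← h _ (pointOfHom_mem_locus φ), coords_pointOfHom]
    rfl
  rw [← val_aeval_coordFun, h0, map_zero]

theorem isIrreducibleVariety_locus [IsAlgClosed K] : IsIrreducibleVariety (locus K u v) := by
  refine ⟨⟨{f | aeval (Sum.elim u fun i => (v i : E)) f = 0}, rfl⟩, ?_, ?_⟩
  · obtain ⟨φ, -⟩ := exists_algHom_ne_zero (K := K) (E := E) (r := 1)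
      ((Set.finite_range u).union ((Set.finite_range (fun i => (v i : E))).union
        (Set.finite_range (fun i => ((v i)⁻¹ : E))))) one_ne_zero
    exact ⟨_, pointOfHom_mem_locus φ⟩
  · rintro _ _ ⟨S₁, rfl⟩ ⟨S₂, rfl⟩ hV
    by_contra! hne
    obtain ⟨⟨g₁, hg₁, h₁⟩, ⟨g₂, hg₂, h₂⟩⟩ :=
      And.intro (Set.not_subset.1 hne.1) (Set.not_subset.1 hne.2)
    simp only [Set.mem_ofPred_eq, not_forall] at h₁ h₂
    obtain ⟨f₁, hf₁, h₁⟩ := h₁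
    obtain ⟨f₂, hf₂, h₂⟩ := h₂
    have h0 := aeval_eq_zero_of_forall_mem_locus (K := K) (u := u) (v := v) (f := f₁ * f₂) (by
      intro g hg
      rw [map_mul]
      rcases hV hg with h | h
      · rw [h f₁ hf₁, zero_mul]
      · rw [h f₂ hf₂, mul_zero])
    rw [map_mul, mul_eq_zero] at h0
    exact h0.elim (fun h => h₁ (hg₁ _ h)) (fun h => h₂ (hg₂ _ h))

/-- The locus is free as soon as its generic point satisfies no additive and no multiplicative
relation. -/
theorem isFree_locus [IsAlgClosed K]
    (hadd : ∀ m : Fin n → ℤ, m ≠ 0 → ∀ b : K, ∑ i, (m i : E) * u i ≠ algebraMap K E b)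
    (hmul : ∀ m : Fin n → ℤ, m ≠ 0 → ∀ b : K,
      ((∏ i, v i ^ m i : Eˣ) : E) ≠ algebraMap K E b) :
    IsFree (locus K u v) := by
  rintro ⟨m, b, hm, h | h⟩
  · refine hmul m hm b ?_
    have h0 : ((∏ i, coordV u v i ^ m i : (coordRing K u v)ˣ) : coordRing K u v) -
        algebraMap K _ b = 0 := by
      refine eq_zero_of_forall_algHom fun φ => ?_
      have := h (pointOfHom_mem_locus φ)
      simp only [Set.mem_ofPred_eq, pointOfHom, ← map_zpow, ← map_prod] at this
      rw [map_sub, AlgHom.commutes, sub_eq_zero]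
      exact this
    have h1 := congrArg (coordRing K u v).val (sub_eq_zero.1 h0)
    rw [AlgHom.commutes] at h1
    rw [← h1]
    simp only [← map_val_coordV (K := K) (u := u) (v := v), ← map_zpow, ← map_prod]
    rfl
  · refine hadd m hm b ?_
    have h0 : ∑ i, (m i : coordRing K u v) * coordU u v i - algebraMap K _ b = 0 := by
      refine eq_zero_of_forall_algHom fun φ => ?_
      have := h (pointOfHom_mem_locus φ)
      rw [map_sub, AlgHom.commutes, sub_eq_zero, map_sum]
      simpa [pointOfHom] using this
    have h1 := congrArg (coordRing K u v).val (sub_eq_zero.1 h0)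
    rw [AlgHom.commutes] at h1
    rw [← h1, map_sum]
    simp [coordU]

/-- The dimension of `[C](locus)` is at least the rank, in the matroid of algebraic independence,
of the coordinates of the image of the generic point. -/
theorem le_dim_matMap_image_locus [IsAlgClosed K] {r : ℕ} (C : Matrix (Fin r) (Fin n) ℤ)
    (hr : (r : ℕ∞) ≤ (AlgebraicIndependent.matroid K E).eRk
      (Set.range (fun i => ∑ j, (C i j : E) * u j) ∪
        Set.range (fun i => ((∏ j, v j ^ C i j : Eˣ) : E)))) :
    (r : Cardinal.{u}) ≤ dim (matMap C '' locus K u v) := by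
  obtain ⟨I, hI, hIi, hIr⟩ := Matroid.le_eRk_iff.1 hr
  rw [← Set.Sum.elim_range] at hI
  set w : Fin r ⊕ Fin r → E := Sum.elim (fun i => ∑ j, (C i j : E) * u j)
    (fun i => ((∏ j, v j ^ C i j : Eˣ) : E)) with hw
  have hvan : ∀ f ∈ MvPolynomial.vanishingIdeal K (coords '' (matMap C '' locus K u v)),
      aeval w f = 0 := by
    intro f hf
    let w' : Fin r ⊕ Fin r → coordRing K u v :=
      Sum.elim (fun i => ∑ j, (C i j : coordRing K u v) * coordU u v j)
        (fun i => ((∏ j, coordV u v j ^ C i j : (coordRing K u v)ˣ) : coordRing K u v))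
    have hw' : w = fun i => (coordRing K u v).val (w' i) := by
      ext (i | i)
      · simp [w, w', coordU]
      · simp only [w, w', Sum.elim_inr]
        simp only [← map_val_coordV (K := K) (u := u) (v := v), ← map_zpow, ← map_prod]
        rfl
    have h0 : aeval w' f = 0 := by
      refine eq_zero_of_forall_algHom fun φ => ?_
      have h1 := (MvPolynomial.mem_vanishingIdeal_iff.1 hf) _
        ⟨_, ⟨_, pointOfHom_mem_locus φ, rfl⟩, rfl⟩
      rw [comp_aeval_apply, ← h1]
      congr 2
      ext (i | i)
      · simp [w', coords, matMap, pointOfHom]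
      · simp only [w', Sum.elim_inr, coords, matMap, pointOfHom, ← map_zpow, ← map_prod]
        rfl
    rw [hw', ← comp_aeval_apply, h0, map_zero]
  let ψ : (MvPolynomial (Fin r ⊕ Fin r) K ⧸
      MvPolynomial.vanishingIdeal K (coords '' (matMap C '' locus K u v))) →ₐ[K] E :=
    Ideal.Quotient.liftₐ _ (aeval w) hvan
  choose i hi using fun x : I => hI x.2
  have hind : AlgebraicIndependent K
      (fun x : I => Ideal.Quotient.mkₐ K
        (MvPolynomial.vanishingIdeal K (coords '' (matMap C '' locus K u v))) (X (i x))) := by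
    refine AlgebraicIndependent.of_comp ψ ?_
    have : (ψ ∘ fun x : I => Ideal.Quotient.mkₐ K _ (X (i x))) = fun x : I => (x : E) := by
      ext x
      rw [← hi x]
      exact aeval_X w (i x)
    rw [this]
    exact AlgebraicIndependent.matroid_indep_iff.1 hIi
  have hcard : Cardinal.mk I = r := by
    have h1 : I.Finite := Set.finite_of_encard_eq_coe hIr
    have := h1.fintype
    rw [Cardinal.mk_fintype, ← Nat.card_eq_fintype_card, Nat.card_coe_set_eq, Set.ncard, hIr]
    simp
  rw [← hcard]
  exact hind.cardinalMk_le_trdeg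

end Locus

/-! ### Rotundity of the locus -/

section Rotund

/-- An integer matrix whose rank is its number of rows has rows that are independent over `ℚ`. -/
theorem linearIndependent_row_of_rank_eq {r n : ℕ} {C : Matrix (Fin r) (Fin n) ℤ}
    (hC : C.rank = r) : LinearIndependent ℚ (fun i j => (C i j : ℚ)) := by
  have hZ : LinearIndependent ℤ (fun i => C i) := by
    rw [Fintype.linearIndependent_iff]
    intro a ha
    by_contra! hne
    obtain ⟨i, hi⟩ := hne
    -- the linear form `a` vanishes on the range of `C`, so that range has rank less than `r`
    let ℓ : (Fin r → ℤ) →ₗ[ℤ] ℤ := ∑ i, a i • LinearMap.proj i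
    have hℓ (x : Fin r → ℤ) : ℓ x = ∑ i, a i * x i := by simp [ℓ]
    have hle : LinearMap.range C.mulVecLin ≤ LinearMap.ker ℓ := by
      rintro _ ⟨x, rfl⟩
      rw [LinearMap.mem_ker, hℓ]
      simp only [Matrix.mulVecLin_apply, Matrix.mulVec, dotProduct, Finset.mul_sum]
      rw [Finset.sum_comm]
      refine Finset.sum_eq_zero fun j _ => ?_
      have := congrFun ha j
      simp only [Finset.sum_apply, Pi.smul_apply, smul_eq_mul, Pi.zero_apply] at this
      simp only [← mul_assoc]
      rw [← Finset.sum_mul, this, zero_mul]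
    have h1 := Submodule.finrank_quotient_add_finrank (LinearMap.ker ℓ)
    rw [ℓ.quotKerEquivRange.finrank_eq] at h1
    have h2 : C.rank ≤ Module.finrank ℤ (LinearMap.ker ℓ) := Submodule.finrank_mono hle
    have h3 : 0 < Module.finrank ℤ (LinearMap.range ℓ) := by
      rw [Module.finrank_pos_iff]
      refine ⟨⟨⟨ℓ (Pi.single i 1), _, rfl⟩, 0, fun h => hi ?_⟩⟩
      have : ℓ (Pi.single i 1) = 0 := congrArg Subtype.val h
      rw [hℓ] at this
      simpa [Pi.single_apply] using this
    rw [Module.finrank_pi, Fintype.card_fin] at h1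
    omega
  rw [← LinearIndependent.iff_fractionRing ℤ ℚ]
  let f : (Fin n → ℤ) →ₗ[ℤ] (Fin n → ℚ) :=
    LinearMap.pi fun j => (Int.castAddHom ℚ).toIntLinearMap.comp (LinearMap.proj j)
  refine hZ.map' f (LinearMap.ker_eq_bot.2 fun x y h => funext fun j => ?_)
  exact Int.cast_injective (α := ℚ) (congrFun h j)

/-- If `W` is the span of `r ≥ 1` independent vectors `c i` of `ℚⁿ`, then for some `l` it contains a
nonzero vector supported on the first `l + 1` coordinates, and the `c i` together with the first `l`
unit vectors and at most `n - r - l` further unit vectors span `ℚⁿ`. -/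
theorem exists_spanning_completion {r n : ℕ} (hr : 1 ≤ r) {c : Fin r → Fin n → ℚ}
    (hrow : LinearIndependent ℚ c) :
    ∃ (l : ℕ) (w : Fin n → ℚ) (J : Set (Fin n)), l < n ∧ w ∈ Submodule.span ℚ (Set.range c) ∧
      w ≠ 0 ∧ (∀ j : Fin n, l < j → w j = 0) ∧ (r : ℕ∞) + l + J.encard ≤ n ∧
      Submodule.span ℚ (Set.range c ∪
        (fun j => Pi.single j 1) '' ({j : Fin n | (j : ℕ) < l} ∪ J)) = ⊤ := by
  set W := Submodule.span ℚ (Set.range c) with hW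
  -- `w` is a nonzero vector of `W` whose support ends as early as possible, at `l`
  have hex : ∃ l : ℕ, ∃ w ∈ W, w ≠ 0 ∧ ∀ j : Fin n, l ≤ j → w j = 0 :=
    ⟨n, _, Submodule.subset_span ⟨⟨0, hr⟩, rfl⟩, hrow.ne_zero _,
      fun j hj => absurd j.2 (not_lt.2 hj)⟩
  classical
  obtain ⟨l, hl⟩ : ∃ l, Nat.find hex = l + 1 := by
    refine Nat.exists_eq_succ_of_ne_zero fun h0 => ?_
    obtain ⟨w, -, hw0, hw⟩ := Nat.find_spec hex
    rw [h0] at hw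
    exact hw0 (funext fun j => hw j (Nat.zero_le _))
  obtain ⟨w, hwW, hw0, hwl⟩ := Nat.find_spec hex
  rw [hl] at hwl
  have hln : l < n := by
    by_contra! h
    refine Nat.find_min hex (m := l) (by omega) ⟨w, hwW, hw0, fun j hj => ?_⟩
    exact absurd j.2 (by omega)
  have hmin : ∀ w ∈ W, (∀ j : Fin n, l ≤ j → w j = 0) → w = 0 := by
    intro w hw h
    by_contra h0
    exact Nat.find_min hex (m := l) (by omega) ⟨w, hw, h0, h⟩
  -- complete the rows and the first `l` unit vectors to a basis by further unit vectors
  let bQ : Fin r ⊕ Fin n → Fin n → ℚ := Sum.elim c (fun j => Pi.single j 1)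
  let I₀ : Set (Fin r ⊕ Fin n) := Set.range Sum.inl ∪ Sum.inr '' {j : Fin n | (j : ℕ) < l}
  have hI₀ : LinearIndepOn ℚ bQ I₀ := by
    refine LinearIndepOn.union ?_ ?_ ?_
    · exact (linearIndepOn_range_iff Sum.inl_injective bQ).2 hrow
    · refine LinearIndepOn.image_of_comp Sum.inr bQ ?_
      exact (Pi.linearIndependent_single_one (Fin n) ℚ).linearIndepOn _
    · rw [Submodule.disjoint_def]
      intro x hx hx'
      refine hmin x (Submodule.span_mono ?_ hx) ?_
      · rintro _ ⟨_, ⟨i, rfl⟩, rfl⟩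
        exact ⟨i, rfl⟩
      · intro j hj
        have hle : Submodule.span ℚ (bQ '' (Sum.inr '' {j : Fin n | (j : ℕ) < l})) ≤
            LinearMap.ker (LinearMap.proj (R := ℚ) (φ := fun _ : Fin n => ℚ) j) := by
          rw [Submodule.span_le]
          rintro _ ⟨_, ⟨i, hi, rfl⟩, rfl⟩
          have hij : j ≠ i := fun h => absurd hj (h ▸ not_le.2 hi)
          simp [bQ, hij]
        exact hle hx'
  obtain ⟨T, hIT, hTind, hTspan⟩ : ∃ T, I₀ ⊆ T ∧ LinearIndepOn ℚ bQ T ∧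
      bQ '' Set.univ ⊆ Submodule.span ℚ (bQ '' T) :=
    ⟨_, hI₀.subset_extend (Set.subset_univ _), hI₀.linearIndepOn_extend (Set.subset_univ _),
      hI₀.image_subset_span_image_extend (Set.subset_univ _)⟩
  have hTn : T.encard ≤ n := by
    have := hTind.encard_le_toENat_rank
    simpa using this
  let J : Set (Fin n) := {j | Sum.inr j ∈ T ∧ l ≤ (j : ℕ)}
  have hcount : (r : ℕ∞) + l + J.encard ≤ n := by
    have hA : (Set.range (Sum.inl : Fin r → Fin r ⊕ Fin n)).encard = r := by
      rw [← Set.image_univ, Sum.inl_injective.encard_image, Set.encard_univ]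
      simp
    have hB : (Sum.inr '' {j : Fin n | (j : ℕ) < l} : Set (Fin r ⊕ Fin n)).encard = l := by
      have : {j : Fin n | (j : ℕ) < l} = (Finset.Iio (⟨l, hln⟩ : Fin n) : Set (Fin n)) := by
        ext j
        simp [Fin.lt_def]
      rw [Sum.inr_injective.encard_image, this, Set.encard_coe_eq_coe_finsetCard, Fin.card_Iio]
    rw [← Sum.inr_injective.encard_image (β := Fin r ⊕ Fin n) J, ← hA, ← hB,
      ← Set.encard_union_eq, ← Set.encard_union_eq]
    · refine (Set.encard_le_encard (Set.union_subset hIT ?_)).trans hTn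
      rintro _ ⟨j, hj, rfl⟩
      exact hj.1
    · rw [Set.disjoint_left]
      rintro _ (⟨i, rfl⟩ | ⟨i, hi, rfl⟩) ⟨j, hj, hij⟩
      · exact Sum.inr_ne_inl hij
      · rw [Sum.inr.injEq] at hij
        exact absurd hj.2 (hij ▸ not_le.2 hi)
    · rw [Set.disjoint_left]
      rintro _ ⟨i, rfl⟩ ⟨j, -, hij⟩
      exact Sum.inr_ne_inl hij
  refine ⟨l, w, J, hln, hwW, hw0, fun j hj => hwl j hj, hcount, ?_⟩
  rw [eq_top_iff, ← (Pi.basisFun ℚ (Fin n)).span_eq, Submodule.span_le]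
  rintro _ ⟨j, rfl⟩
  rw [Pi.basisFun_apply]
  refine Submodule.span_mono ?_ (hTspan ⟨Sum.inr j, trivial, rfl⟩)
  rintro _ ⟨i | i, hi, rfl⟩
  · exact Or.inl ⟨i, rfl⟩
  · refine Or.inr ⟨i, ?_, rfl⟩
    by_cases h : l ≤ (i : ℕ)
    · exact Or.inr ⟨hi, h⟩
    · exact Or.inl (not_le.1 h)

variable {K E : Type u} [Field K] [Field E] [Algebra K E]

open AlgebraicIndependent (matroid)

theorem mem_matroid_closure_iff {s : Set E} {a : E} :
    a ∈ (matroid K E).closure s ↔ IsAlgebraic (Algebra.adjoin K s) a := by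
  rw [AlgebraicIndependent.matroid_closure_eq]
  rfl

theorem mem_matroid_closure_of_mem {s : Set E} {a : E} (ha : a ∈ s) :
    a ∈ (matroid K E).closure s :=
  mem_matroid_closure_iff.2
    (isAlgebraic_algebraMap (⟨a, Algebra.subset_adjoin ha⟩ : Algebra.adjoin K s))

theorem unitFrac_subset_matroid_closure {σ : Type*} {z : σ → E} {s : Set E}
    (hz : ∀ i, z i ∈ (matroid K E).closure s) {a : E} (ha : a ∈ unitFrac K z) :
    a ∈ (matroid K E).closure s := by
  obtain ⟨P, Q, hQ, h⟩ := ha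
  rw [AlgebraicIndependent.matroid_closure_eq] at hz ⊢
  have key (P : MvPolynomial σ K) :
      aeval z P ∈ ((Subalgebra.algebraicClosure (Algebra.adjoin K s) E).restrictScalars K) :=
    aeval_mem_of_forall_mem hz P
  have hQ0 := hQ.ne_zero
  have : a = aeval z P * (aeval z Q)⁻¹ := by rw [← h]; field_simp
  rw [this]
  have hP : IsAlgebraic (Algebra.adjoin K s) (aeval z P) := key P
  have hQ : IsAlgebraic (Algebra.adjoin K s) (aeval z Q) := key Q
  exact hP.mul hQ.inv

/-- If the exponent vector `q` depends `ℚ`-linearly on integer exponent vectors whose monomials are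
algebraic over `s`, then the monomial of some multiple of `q` is algebraic over `s`. -/
theorem exists_prod_zpow_mem_closure {n : ℕ} (v : Fin n → Eˣ) (s : Set E) {ι : Type*}
    (b : ι → Fin n → ℤ)
    (hb : ∀ i, ((∏ j, v j ^ b i j : Eˣ) : E) ∈ (matroid K E).closure s) {q : Fin n → ℚ}
    (hq : q ∈ Submodule.span ℚ (Set.range fun i j => (b i j : ℚ))) :
    ∃ (N : ℕ) (k : Fin n → ℤ), 0 < N ∧ (∀ j, (k j : ℚ) = N * q j) ∧
      ((∏ j, v j ^ k j : Eˣ) : E) ∈ (matroid K E).closure s := by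
  simp only [mem_matroid_closure_iff] at hb ⊢
  have hzpow {x : Eˣ} (hx : IsAlgebraic (Algebra.adjoin K s) (x : E)) (m : ℤ) :
      IsAlgebraic (Algebra.adjoin K s) ((x ^ m : Eˣ) : E) := by
    cases m with
    | ofNat m => simpa using hx.pow m
    | negSucc m => simpa [zpow_negSucc] using (hx.pow (m + 1)).inv
  induction hq using Submodule.span_induction with
  | mem x hx =>
    obtain ⟨i, rfl⟩ := hx
    exact ⟨1, b i, one_pos, by simp, hb i⟩
  | zero => exact ⟨1, 0, one_pos, by simp, by simpa using isAlgebraic_one⟩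
  | add x y _ _ hx hy =>
    obtain ⟨N, k, hN, hk, h⟩ := hx
    obtain ⟨N', k', hN', hk', h'⟩ := hy
    refine ⟨N * N', fun j => k j * N' + k' j * N, by positivity, fun j => ?_, ?_⟩
    · push_cast
      rw [hk, hk', Pi.add_apply]
      ring
    · have : (∏ j, v j ^ (k j * N' + k' j * N) : Eˣ) =
          (∏ j, v j ^ k j) ^ (N' : ℤ) * (∏ j, v j ^ k' j) ^ (N : ℤ) := by
        simp only [zpow_add, Finset.prod_mul_distrib, zpow_mul, Finset.prod_zpow]
      rw [this, Units.val_mul]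
      exact (hzpow h _).mul (hzpow h' _)
  | smul a x _ hx =>
    obtain ⟨N, k, hN, hk, h⟩ := hx
    refine ⟨a.den * N, fun j => k j * a.num, Nat.mul_pos a.den_pos hN, fun j => ?_, ?_⟩
    · push_cast
      rw [hk, Pi.smul_apply, smul_eq_mul]
      have := Rat.den_mul_eq_num a
      linear_combination (-(N : ℚ) * x j) * this
    · have : (∏ j, v j ^ (k j * a.num) : Eˣ) = (∏ j, v j ^ k j) ^ a.num := by
        simp only [zpow_mul, Finset.prod_zpow]
      rw [this]
      exact hzpow h _

variable {n : ℕ} {y : Fin n → E} {u : Fin n → E} {v : Fin n → Eˣ}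

/-- The locus of `(u, v)` is rotund if `v₀, …, vₙ₋₂` together with one more element form a
transcendence basis `y`, if each `uⱼ` is a rational function of `y₀, …, yⱼ`, and if no nontrivial
rational combination of the `uⱼ` is a constant. -/
theorem isRotund_locus [CharZero K] [IsAlgClosed K] (hy : IsTranscendenceBasis K y)
    (hv : ∀ (j : Fin n) (h : (j : ℕ) + 1 < n), (v j : E) = y ⟨j + 1, h⟩)
    (hu : ∀ j, u j ∈ unitFrac K (fun i : Set.Iic j => y i))
    (hind : ∀ w : Fin n → ℚ, w ≠ 0 → ∀ c : K, ∑ j, (w j : E) * u j ≠ algebraMap K E c) :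
    IsRotund (locus K u v) := by
  intro r C hr hrn hC
  refine le_dim_matMap_image_locus C ?_
  have hrow := linearIndependent_row_of_rank_eq hC
  set M := matroid K E with hM
  set S : Set E := Set.range (fun i => ∑ j, (C i j : E) * u j) ∪
    Set.range (fun i => ((∏ j, v j ^ C i j : Eˣ) : E)) with hS
  have : CharZero E := charZero_of_injective_algebraMap (algebraMap K E).injective
  obtain ⟨l, w, J, hln, hwW, hw0, hwl, hcount, hspan⟩ := exists_spanning_completion hr hrow
  set Y : Set E := y '' Set.Iic ⟨l, hln⟩ with hY
  -- the combination of the `u`'s given by `w` lies in the closures of both `S` and `Y`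
  set g : E := ∑ j, (w j : E) * u j with hg
  have hgS : g ∈ M.closure S := by
    have hmem : ∀ w ∈ Submodule.span ℚ (Set.range fun i j => (C i j : ℚ)), ∑ j, (w j : E) * u j ∈ Algebra.adjoin K S := by
      intro w hw
      induction hw using Submodule.span_induction with
      | mem x hx =>
        obtain ⟨i, rfl⟩ := hx
        refine Algebra.subset_adjoin (Or.inl ⟨i, ?_⟩)
        simp
      | zero => simp
      | add x y _ _ hx hy =>
        have : ∑ j, ((x + y) j : E) * u j = ∑ j, (x j : E) * u j + ∑ j, (y j : E) * u j := by
          simp [add_mul, Finset.sum_add_distrib]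
        exact this ▸ add_mem hx hy
      | smul a x _ hx =>
        have : ∑ j, ((a • x) j : E) * u j = algebraMap K E a * ∑ j, (x j : E) * u j := by
          simp [Finset.mul_sum, mul_assoc]
        exact this ▸ mul_mem (Subalgebra.algebraMap_mem _ _) hx
    exact mem_matroid_closure_iff.2
      (isAlgebraic_algebraMap (⟨g, hmem w hwW⟩ : Algebra.adjoin K S))
  have hgY : g ∈ M.closure Y := by
    have hYc (i : Set.Iic (⟨l, hln⟩ : Fin n)) : y i ∈ M.closure Y :=
      mem_matroid_closure_of_mem ⟨i, i.2, rfl⟩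
    refine unitFrac_subset_matroid_closure hYc (sum_mem fun j _ => ?_)
    by_cases hj : (j : ℕ) ≤ l
    · refine mul_mem ?_ (unitFrac_le (fun i => ?_) (hu j))
      · have : (w j : E) = algebraMap K E (w j) := by simp
        exact this ▸ Subalgebra.algebraMap_mem _ _
      · exact apply_mem_unitFrac (fun i : Set.Iic (⟨l, hln⟩ : Fin n) => y i)
          ⟨i, le_trans (Set.mem_Iic.1 i.2) hj⟩
    · rw [hwl j (by omega)]
      simp
  have hg1 : M.eRk {g} = 1 := by
    refine Matroid.IsNonloop.eRk_eq ?_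
    rw [← Matroid.indep_singleton, hM, AlgebraicIndependent.matroid_indep_iff]
    have hgt : Transcendental K g := fun halg => by
      obtain ⟨c, hc⟩ := minpoly.mem_range_of_degree_eq_one K g
        (IsAlgClosed.degree_eq_one_of_irreducible K (minpoly.irreducible halg.isIntegral))
      exact hind w hw0 c hc.symm
    exact algebraicIndependent_unique_type_iff.2 hgt
  have hSY : M.eRk (S ∪ Y) + 1 ≤ M.eRk S + (l + 1 : ℕ) := by
    have h1 := M.eRk_inter_add_eRk_union_le (M.closure S) (M.closure Y)
    rw [M.eRk_closure_eq, M.eRk_closure_eq] at h1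
    have h2 : 1 ≤ M.eRk (M.closure S ∩ M.closure Y) :=
      hg1 ▸ M.eRk_mono (Set.singleton_subset_iff.2 ⟨hgS, hgY⟩)
    have h3 : M.eRk (S ∪ Y) ≤ M.eRk (M.closure S ∪ M.closure Y) :=
      M.eRk_mono (Set.union_subset_union (M.subset_closure S) (M.subset_closure Y))
    have h4 : M.eRk Y ≤ (l + 1 : ℕ) := by
      refine (M.eRk_le_encard Y).trans ((Set.encard_image_le _ _).trans ?_)
      rw [← Finset.coe_Iic, Set.encard_coe_eq_coe_finsetCard, Fin.card_Iic]
    rw [add_comm]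
    exact (add_le_add h2 h3).trans (h1.trans (add_le_add_right h4 _))
  set Z : Set E := S ∪ Y ∪ (fun j => (v j : E)) '' J with hZ
  let b : Fin r ⊕ ↑({j : Fin n | (j : ℕ) < l} ∪ J) → Fin n → ℤ :=
    Sum.elim (fun i => C i) (fun j => Pi.single (j : Fin n) 1)
  have hbZ (i) : ((∏ j, v j ^ b i j : Eˣ) : E) ∈ M.closure Z := by
    refine mem_matroid_closure_of_mem ?_
    obtain i | ⟨j, hj⟩ := i
    · exact Or.inl (Or.inl (Or.inr ⟨i, rfl⟩))
    · have h1 : (∏ j', v j' ^ b (Sum.inr ⟨j, hj⟩) j' : Eˣ) = v j := by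
        rw [Finset.prod_eq_single j]
        · simp [b]
        · intro j' _ hj'
          simp [b, hj']
        · simp
      rw [h1]
      by_cases hjJ : j ∈ J
      · exact Or.inr ⟨j, hjJ, rfl⟩
      · have hj : (j : ℕ) < l := hj.resolve_right hjJ
        refine Or.inl (Or.inr ⟨⟨j + 1, by omega⟩, ?_, (hv j (by omega)).symm⟩)
        rw [Set.mem_Iic, Fin.le_def]
        simp only
        omega
  have hvZ (j : Fin n) : (v j : E) ∈ M.closure Z := by
    have hspan' : (Pi.single j 1 : Fin n → ℚ) ∈
        Submodule.span ℚ (Set.range fun i j => (b i j : ℚ)) := by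
      refine Submodule.span_mono ?_ (hspan ▸ Submodule.mem_top : _ ∈ Submodule.span ℚ (_ ∪ _))
      rintro _ (⟨i, rfl⟩ | ⟨j, hj, rfl⟩)
      · exact ⟨Sum.inl i, rfl⟩
      · refine ⟨Sum.inr ⟨j, hj⟩, funext fun i => ?_⟩
        simp [b, Pi.single_apply]
    obtain ⟨N, k, hN, hk, h⟩ := exists_prod_zpow_mem_closure v Z b hbZ hspan'
    have h1 : (∏ j', v j' ^ k j' : Eˣ) = v j ^ N := by
      rw [Finset.prod_eq_single j]
      · have : k j = N := by
          have := hk j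
          rw [Pi.single_eq_same, mul_one] at this
          exact_mod_cast this
        rw [this, zpow_natCast]
      · intro j' _ hj'
        have : k j' = 0 := by
          have := hk j'
          rw [Pi.single_eq_of_ne hj', mul_zero] at this
          exact_mod_cast this
        rw [this, zpow_zero]
      · simp
    rw [h1, Units.val_pow_eq_pow_val, mem_matroid_closure_iff] at h
    exact mem_matroid_closure_iff.2 (h.of_pow hN)
  have hyZ : Set.range y ⊆ M.closure Z := by
    rintro _ ⟨⟨i, hi⟩, rfl⟩
    cases i with
    | zero => exact mem_matroid_closure_of_mem (Or.inl (Or.inr ⟨_, Nat.zero_le _, rfl⟩))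
    | succ i => exact hv ⟨i, by omega⟩ hi ▸ hvZ ⟨i, by omega⟩
  have hnZ : (n : ℕ∞) ≤ M.eRk (S ∪ Y) + J.encard := by
    have hyi : M.Indep (Set.range y) :=
      AlgebraicIndependent.matroid_indep_iff.2 hy.1.coe_range
    have h1 : (n : ℕ∞) = M.eRk (Set.range y) := by
      rw [hyi.eRk_eq_encard, ← Set.image_univ, hy.1.injective.encard_image, Set.encard_univ]
      simp
    rw [h1]
    refine (M.eRk_mono hyZ).trans ?_
    rw [M.eRk_closure_eq]
    exact (M.eRk_union_le_eRk_add_encard _ _).trans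
      (add_le_add_right (Set.encard_image_le _ _) _)
  clear_value M S Y
  have hJn : J.encard ≠ ⊤ := fun h => by simp [h] at hcount
  generalize J.encard = cJ at *
  generalize M.eRk (S ∪ Y) = cU at *
  generalize M.eRk S = cS at *
  lift cJ to ℕ using hJn
  cases cS with
  | top => exact le_top
  | coe cS =>
    cases cU with
    | top =>
      rw [top_add] at hSY
      exact absurd hSY (by simp)
    | coe cU =>
      norm_cast at *
      omega

end Rotund

/-! ### Towers of exponentials -/

section ERing

variable {R : Type u} [CommRing R] [ERing R]

theorem expU_zero : expU (0 : R) = 1 := map_one ERing.expHom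

theorem expU_sub (r s : R) : expU (r - s) = expU r / expU s :=
  map_div ERing.expHom (Multiplicative.ofAdd r) (Multiplicative.ofAdd s)

theorem expU_zsmul (m : ℤ) (r : R) : expU (m • r) = expU r ^ m :=
  map_zpow ERing.expHom (Multiplicative.ofAdd r) m

theorem expU_nsmul (m : ℕ) (r : R) : expU (m • r) = expU r ^ m :=
  map_pow ERing.expHom (Multiplicative.ofAdd r) m

theorem expU_sum {ι : Type*} (s : Finset ι) (f : ι → R) :
    expU (∑ i ∈ s, f i) = ∏ i ∈ s, expU (f i) := by
  classical
  induction s using Finset.induction_on with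
  | empty => simp [expU_zero]
  | insert a s ha ih => rw [Finset.sum_insert ha, Finset.prod_insert ha, expU_add, ih]

/-- The sequence `x, exp f₀, exp f₁, …`. -/
def expVars (x : R) (f : ℕ → R) : ℕ → R
  | 0 => x
  | i + 1 => (expU (f i) : Rˣ)

end ERing

section Tower

variable {K : Type u} [Field K] [CharZero K] [ERing K]

/-- The `K`-algebra structure of `K[x]^E` given by the constants. -/
instance : Algebra K (ExpPoly K) := (ExpPoly.C K).toAlgebra

namespace ExpPoly

/-- Evaluation at `a` as a homomorphism of `K`-algebras. -/
def evalₐ (a : K) : ExpPoly K →ₐ[K] K where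
  __ := eval a
  commutes' := eval_C a

theorem expU_algebraMap (c : K) :
    (expU (algebraMap K (ExpPoly K) c) : ExpPoly K) = algebraMap K (ExpPoly K) (expU c : Kˣ) :=
  expU_C c

/-- `K[x]^E` is generated by `x` as a `K`-algebra with exponentiation. -/
theorem eq_top_of_expU_mem (A : Subalgebra K (ExpPoly K)) (hX : X K ∈ A)
    (hexp : ∀ f ∈ A, (expU f : ExpPoly K) ∈ A) : A = ⊤ := by
  have key (n : ℕ) : ∀ r, of K n r ∈ A := by
    induction n with
    | zero =>
      intro r
      change Polynomial K at r
      induction r using Polynomial.induction_on' with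
      | add p q hp hq => exact (map_add (of K 0) p q) ▸ add_mem hp hq
      | monomial n a =>
        rw [← Polynomial.C_mul_X_pow_eq_monomial]
        refine (map_mul (of K 0) _ _) ▸ mul_mem (A.algebraMap_mem a) ?_
        exact (map_pow (of K 0) _ _) ▸ pow_mem hX n
    | succ n ih =>
      intro r
      change AddMonoidAlgebra (chain K n).carrier (chain K n).compl at r
      induction r using AddMonoidAlgebra.induction_on with
      | of b =>
        have h1 : (chain K n).nextExp (Multiplicative.ofAdd (b : (chain K n).carrier)) =
            AddMonoidAlgebra.of (chain K n).carrier (chain K n).compl (Multiplicative.ofAdd b) := by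
          have h₁ : Submodule.projectionOnto (chain K n).dom (chain K n).compl (chain K n).isCompl
              (b : (chain K n).carrier) = 0 :=
            Submodule.projectionOnto_apply_right _ b
          have h₂ : Submodule.projectionOnto (chain K n).compl (chain K n).dom
              (chain K n).isCompl.symm (b : (chain K n).carrier) = b :=
            Submodule.projectionOnto_apply_left _ b
          simp [PartialERing.nextExp, h₁, h₂]
        rw [← h1]
        exact hexp _ (ih b)
      | add x y hx hy => exact (map_add (of K (n + 1)) x y) ▸ add_mem hx hy
      | smul c x hx =>
        have h1 : c • x = (chain K n).toNext c * x := by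
          exact Algebra.smul_def c x
        rw [h1]
        refine (map_mul (of K (n + 1)) _ _) ▸ mul_mem ?_ hx
        exact (of_chainStep K n c) ▸ ih c
  rw [eq_top_iff]
  intro p _
  obtain ⟨n, r, -, rfl, -⟩ := exists_of₂ K p p
  exact key n r

end ExpPoly

open ExpPoly (eval evalₐ)

/-- The elements of `K[x]^E` that are fractions, with denominator a unit, of polynomials in
`x, exp f₀, …, exp fₙ₋₁`. -/
def level (f : ℕ → ExpPoly K) (n : ℕ) : Subalgebra K (ExpPoly K) :=
  unitFrac K (fun j : Fin (n + 1) => expVars (ExpPoly.X K) f j)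

/-- A tower of length `n`: a sequence `f₀, …, fₙ₋₁` of exponential polynomials starting with a
multiple of `x`, each expressible by `x` and the exponentials of the previous ones, and
`ℚ`-linearly independent modulo constants. (Only the first `n` terms of `f` matter, except that
`f 0` is always required to be a multiple of `x`.) -/
structure IsTower (f : ℕ → ExpPoly K) (n : ℕ) : Prop where
  base : ∃ κ : K, κ ≠ 0 ∧ f 0 = κ • ExpPoly.X K
  mem : ∀ i < n, f i ∈ level f i
  indep : ∀ (w : Fin n → ℚ) (c : K),
    ∑ i, ((w i : ℚ) : K) • f i = algebraMap K (ExpPoly K) c → w = 0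

theorem expVars_mem_level (f : ℕ → ExpPoly K) {n j : ℕ} (h : j ≤ n) :
    expVars (ExpPoly.X K) f j ∈ level f n :=
  apply_mem_unitFrac (fun j : Fin (n + 1) => expVars (ExpPoly.X K) f j) ⟨j, Nat.lt_succ_of_le h⟩

theorem X_mem_level (f : ℕ → ExpPoly K) (n : ℕ) : ExpPoly.X K ∈ level f n :=
  expVars_mem_level f (Nat.zero_le n)

theorem expU_mem_level (f : ℕ → ExpPoly K) {n i : ℕ} (h : i < n) :
    (expU (f i) : ExpPoly K) ∈ level f n :=
  expVars_mem_level f (j := i + 1) h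

theorem level_le {f : ℕ → ExpPoly K} {n : ℕ} {f' : ℕ → ExpPoly K} {m : ℕ}
    (h : ∀ i < n, (expU (f i) : ExpPoly K) ∈ level f' m) : level f n ≤ level f' m := by
  refine unitFrac_le fun j => ?_
  obtain ⟨_ | j, hj⟩ := j
  · exact X_mem_level f' m
  · exact h j (by omega)

theorem level_mono (f : ℕ → ExpPoly K) {m n : ℕ} (h : m ≤ n) : level f m ≤ level f n :=
  level_le fun _ hi => expU_mem_level f (hi.trans_le h)

theorem IsTower.of_le {f : ℕ → ExpPoly K} {m n : ℕ} (h : IsTower f n) (hmn : m ≤ n) :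
    IsTower f m where
  base := h.base
  mem i hi := h.mem i (hi.trans_le hmn)
  indep w c hw := by
    obtain ⟨d, rfl⟩ := Nat.exists_eq_add_of_le hmn
    have h0 := h.indep (Fin.append w 0) c (by simpa [Fin.sum_univ_add] using hw)
    ext i
    simpa using congrFun h0 (Fin.castAdd d i)

theorem isTower_X : IsTower (fun _ => ExpPoly.X K) 1 where
  base := ⟨1, one_ne_zero, by simp⟩
  mem i _ := X_mem_level _ i
  indep w c h := by
    have h0 := congrArg (evalₐ 0) h
    have h1 := congrArg (evalₐ 1) h
    have hX (a : K) : evalₐ a (ExpPoly.X K) = a := ExpPoly.eval_X a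
    simp only [Finset.univ_unique, Finset.sum_singleton, map_smul, AlgHom.commutes, hX,
      smul_eq_mul, mul_zero, mul_one] at h0 h1
    ext i
    rw [Subsingleton.elim i default]
    rw [← h0] at h1
    simpa using h1

/-- Appending an exponential polynomial that is independent of a tower. -/
theorem IsTower.update {f : ℕ → ExpPoly K} {n : ℕ} (hn : 1 ≤ n) (h : IsTower f n) {p : ExpPoly K}
    (hp : p ∈ level f n)
    (hpi : ¬ ∃ (q : Fin n → ℚ) (c : K), p = ∑ i, ((q i : ℚ) : K) • f i + algebraMap K _ c) :
    IsTower (Function.update f n p) (n + 1) ∧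
      level f n ≤ level (Function.update f n p) n := by
  have hne {i : ℕ} (hi : i < n) : Function.update f n p i = f i :=
    Function.update_of_ne hi.ne _ _
  have hle {i : ℕ} (hi : i ≤ n) : level f i ≤ level (Function.update f n p) i :=
    level_le fun j hj => hne (hj.trans_le hi) ▸ expU_mem_level _ hj
  refine ⟨⟨?_, ?_, ?_⟩, hle le_rfl⟩
  · rw [hne hn]
    exact h.base
  · intro i hi
    rcases Nat.lt_succ_iff_lt_or_eq.1 hi with hi | rfl
    · rw [hne hi]
      exact hle hi.le (h.mem i hi)
    · rw [Function.update_self]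
      exact hle le_rfl hp
  · intro w c hw
    have hcast (i : Fin n) : Function.update f n p (i.castSucc : Fin (n + 1)) = f i := hne i.2
    have hlast : Function.update f n p (Fin.last n : Fin (n + 1)) = p :=
      Function.update_self n p f
    rw [Fin.sum_univ_castSucc, hlast] at hw
    simp only [hcast] at hw
    have hw0 : w (Fin.last n) = 0 := by
      by_contra hne0
      have hK : ((w (Fin.last n) : ℚ) : K) ≠ 0 := Rat.cast_ne_zero.2 hne0
      refine hpi ⟨fun i => -(w (Fin.last n))⁻¹ * w i.castSucc, ((w (Fin.last n) : ℚ) : K)⁻¹ * c, ?_⟩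
      have hcoeff (i : Fin n) : (((-(w (Fin.last n))⁻¹ * w i.castSucc : ℚ)) : K) =
          -(((w (Fin.last n) : ℚ) : K)⁻¹ * (w i.castSucc : ℚ)) := by
        push_cast
        rw [neg_mul]
      have h1 : ((w (Fin.last n) : ℚ) : K) • p = algebraMap K _ c -
          ∑ i : Fin n, ((w i.castSucc : ℚ) : K) • f i := eq_sub_of_add_eq' hw
      rw [← inv_smul_smul₀ hK p, h1, smul_sub, Finset.smul_sum, sub_eq_neg_add,
        ← Finset.sum_neg_distrib]
      simp only [hcoeff, neg_smul, mul_smul]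
      rw [map_mul, Algebra.smul_def]
    rw [hw0, Rat.cast_zero, zero_smul, add_zero] at hw
    have h1 := h.indep (fun i => w i.castSucc) c hw
    ext i
    refine Fin.lastCases ?_ (fun i => ?_) i
    · exact hw0
    · exact congrFun h1 i

/-- Dividing a tower by a nonzero integer. -/
theorem IsTower.smul {f : ℕ → ExpPoly K} {n : ℕ} (h : IsTower f n) {b : ℤ} (hb : b ≠ 0) :
    IsTower (fun i => ((b : K)⁻¹) • f i) n ∧
      level f n ≤ level (fun i => ((b : K)⁻¹) • f i) n := by
  have hbK : (b : K) ≠ 0 := Int.cast_ne_zero.2 hb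
  have hexp (i : ℕ) : expU (f i) = expU (((b : K)⁻¹) • f i) ^ b := by
    rw [← expU_zsmul, ← Int.cast_smul_eq_zsmul K, smul_smul, mul_inv_cancel₀ hbK, one_smul]
  have hle (i : ℕ) : level f i ≤ level (fun i => ((b : K)⁻¹) • f i) i :=
    level_le fun j hj => hexp j ▸
      units_zpow_mem_unitFrac (expU_mem_level (fun i => ((b : K)⁻¹) • f i) hj) b
  refine ⟨⟨?_, ?_, ?_⟩, hle n⟩
  · obtain ⟨κ, hκ, h0⟩ := h.base
    exact ⟨(b : K)⁻¹ * κ, mul_ne_zero (inv_ne_zero hbK) hκ, by rw [h0, smul_smul]⟩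
  · exact fun i hi => Subalgebra.smul_mem _ (hle i (h.mem i hi)) _
  · intro w c hw
    have h1 := h.indep (fun i => w i * (b : ℚ)⁻¹) c (by
      rw [← hw]
      refine Finset.sum_congr rfl fun i _ => ?_
      rw [smul_smul]
      push_cast
      rfl)
    ext i
    simpa [hb] using congrFun h1 i

/-- A tower can be modified, with its level growing, so that the exponential of a given element of
the level belongs to the level. -/
theorem IsTower.exists_expU_mem {f : ℕ → ExpPoly K} {n : ℕ} (hn : 1 ≤ n) (h : IsTower f n)
    {p : ExpPoly K} (hp : p ∈ level f n) :
    ∃ f' n', 1 ≤ n' ∧ IsTower f' n' ∧ level f n ≤ level f' n' ∧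
      (expU p : ExpPoly K) ∈ level f' n' := by
  by_cases hpi : ∃ (q : Fin n → ℚ) (c : K), p = ∑ i, ((q i : ℚ) : K) • f i + algebraMap K _ c
  · obtain ⟨q, c, hq⟩ := hpi
    obtain ⟨⟨b, hb⟩, hbq⟩ := IsLocalization.exist_integer_multiples_of_finite (nonZeroDivisors ℤ) q
    have hb0 : b ≠ 0 := nonZeroDivisors.ne_zero hb
    choose m hm using hbq
    obtain ⟨h1, h2⟩ := h.smul hb0
    refine ⟨_, n, hn, h1, h2, ?_⟩
    have hbK : (b : K) ≠ 0 := Int.cast_ne_zero.2 hb0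
    have hp' : p = ∑ i : Fin n, m i • ((b : K)⁻¹ • f i) + algebraMap K _ c := by
      rw [hq]
      congr 1
      refine Finset.sum_congr rfl fun i _ => ?_
      have h3 : (m i : ℚ) = b * q i := by simpa using hm i
      have h4 : (m i : K) = b * (q i : K) := by exact_mod_cast congrArg (Rat.cast : ℚ → K) h3
      rw [← Int.cast_smul_eq_zsmul K, smul_smul, h4, mul_assoc, mul_comm (q i : K),
        mul_inv_cancel_left₀ hbK]
    rw [hp', expU_add, expU_sum, Units.val_mul, ExpPoly.expU_algebraMap]
    refine mul_mem ?_ (Subalgebra.algebraMap_mem _ _)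
    simp only [expU_zsmul]
    exact units_prod_zpow_mem_unitFrac _ (fun i _ => expU_mem_level _ i.2) _
  · obtain ⟨h1, h2⟩ := h.update hn hp hpi
    refine ⟨_, n + 1, by omega, h1, h2.trans (level_mono _ n.le_succ), ?_⟩
    have := expU_mem_level (Function.update f n p) (n := n + 1) (i := n) (by omega)
    rwa [Function.update_self] at this

variable (K) in
/-- The exponential polynomials that can be reached from any tower. -/
def reachable : Subalgebra K (ExpPoly K) where
  carrier := {p | ∀ f n, 1 ≤ n → IsTower f n →
    ∃ f' n', 1 ≤ n' ∧ IsTower f' n' ∧ level f n ≤ level f' n' ∧ p ∈ level f' n'}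
  mul_mem' := by
    intro a b ha hb f n hn h
    obtain ⟨f₁, n₁, hn₁, h₁, hl₁, ha⟩ := ha f n hn h
    obtain ⟨f₂, n₂, hn₂, h₂, hl₂, hb⟩ := hb f₁ n₁ hn₁ h₁
    exact ⟨f₂, n₂, hn₂, h₂, hl₁.trans hl₂, mul_mem (hl₂ ha) hb⟩
  add_mem' := by
    intro a b ha hb f n hn h
    obtain ⟨f₁, n₁, hn₁, h₁, hl₁, ha⟩ := ha f n hn h
    obtain ⟨f₂, n₂, hn₂, h₂, hl₂, hb⟩ := hb f₁ n₁ hn₁ h₁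
    exact ⟨f₂, n₂, hn₂, h₂, hl₁.trans hl₂, add_mem (hl₂ ha) hb⟩
  algebraMap_mem' c f n hn h := ⟨f, n, hn, h, le_rfl, Subalgebra.algebraMap_mem _ c⟩

/-- Every exponential polynomial is a fraction of polynomials in the exponentials of a tower. -/
theorem exists_isTower_mem_level (p : ExpPoly K) : ∃ f n, IsTower f n ∧ p ∈ level f n := by
  have htop : reachable K = ⊤ := by
    refine ExpPoly.eq_top_of_expU_mem _ (fun f n hn h => ⟨f, n, hn, h, le_rfl, X_mem_level f n⟩) ?_
    intro p hp f n hn h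
    obtain ⟨f₁, n₁, hn₁, h₁, hl₁, hp⟩ := hp f n hn h
    obtain ⟨f₂, n₂, hn₂, h₂, hl₂, hp⟩ := h₁.exists_expU_mem hn₁ hp
    exact ⟨f₂, n₂, hn₂, h₂, hl₁.trans hl₂, hp⟩
  have hp : p ∈ reachable K := htop ▸ Algebra.mem_top
  obtain ⟨f, n, -, h, -, hpf⟩ := hp _ 1 le_rfl isTower_X
  exact ⟨f, n, h, hpf⟩

end Tower

/-! ### Polynomials in the variables of a tower -/

section LastVariable

variable (K : Type*) [Field K] (n : ℕ)

/-- Polynomials in `n + 1` variables as polynomials in the last variable. -/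
def lastEquiv : MvPolynomial (Fin (n + 1)) K ≃ₐ[K] Polynomial (MvPolynomial (Fin n) K) :=
  (renameEquiv K finSuccEquivLast).trans (optionEquivLeft K (Fin n))

variable {K n}

theorem lastEquiv_X_castSucc (i : Fin n) :
    lastEquiv K n (X i.castSucc) = Polynomial.C (X i) := by
  simp [lastEquiv]

theorem lastEquiv_X_last : lastEquiv K n (X (Fin.last n)) = Polynomial.X := by
  simp [lastEquiv]

theorem aeval_eq_eval₂_lastEquiv {S : Type*} [CommRing S] [Algebra K S] (z : Fin (n + 1) → S)
    (P : MvPolynomial (Fin (n + 1)) K) :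
    aeval z P = (lastEquiv K n P).eval₂ (aeval fun i => z (Fin.castSucc i) : _ →ₐ[K] S).toRingHom
      (z (Fin.last n)) := by
  induction P using MvPolynomial.induction_on with
  | C a =>
    have : lastEquiv K n (C a) = Polynomial.C (C a) := (lastEquiv K n).commutes a
    rw [this]
    simp
  | add p q hp hq => rw [map_add, map_add, Polynomial.eval₂_add, hp, hq]
  | mul_X p i hp =>
    rw [map_mul, map_mul, Polynomial.eval₂_mul, hp]
    congr 1
    refine Fin.lastCases ?_ (fun i => ?_) i
    · rw [lastEquiv_X_last]; simp
    · rw [lastEquiv_X_castSucc]; simp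

end LastVariable

/-- In a linear relation between three monomials, two of which have nonzero coefficients, these two
have the same exponents. -/
theorem eq_of_monomial_add_monomial_eq {σ K : Type*} [Field K] {s₀ s₁ s₂ : σ →₀ ℕ} {k₀ k₁ k₂ : K}
    (h₀ : k₀ ≠ 0) (h₁ : k₁ ≠ 0)
    (h : monomial s₀ k₀ + monomial s₂ k₂ = (monomial s₁ k₁ : MvPolynomial σ K)) : s₀ = s₁ := by
  classical
  by_contra hne
  have e0 := congrArg (coeff s₀) h
  have e1 := congrArg (coeff s₁) h
  rw [coeff_add, coeff_monomial, coeff_monomial, coeff_monomial, if_pos rfl,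
    if_neg (Ne.symm hne)] at e0
  rw [coeff_add, coeff_monomial, coeff_monomial, coeff_monomial, if_neg hne, if_pos rfl,
    zero_add] at e1
  by_cases h20 : s₂ = s₀
  · rw [if_neg (h20 ▸ hne)] at e1
    exact h₁ e1.symm
  · rw [if_neg h20, add_zero] at e0
    exact h₀ e0

section Split

variable {K : Type u} [Field K] [CharZero K] [ERing K]

open ExpPoly (eval evalₐ)

/-- The values at `a` of `x, exp f₀, exp f₁, …`. -/
def valuesAt (f : ℕ → ExpPoly K) (a : K) (j : ℕ) : K := eval a (expVars (ExpPoly.X K) f j)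

theorem valuesAt_zero (f : ℕ → ExpPoly K) (a : K) : valuesAt f a 0 = a := ExpPoly.eval_X a

theorem valuesAt_succ (f : ℕ → ExpPoly K) (a : K) (i : ℕ) :
    valuesAt f a (i + 1) = (expU (eval a (f i)) : Kˣ) := ExpPoly.eval_expU a (f i)

theorem valuesAt_succ_ne_zero (f : ℕ → ExpPoly K) (a : K) (i : ℕ) :
    valuesAt f a (i + 1) ≠ 0 := by
  rw [valuesAt_succ]
  exact Units.ne_zero _

theorem eval_aeval_expVars {σ : Type*} (j : σ → ℕ) (f : ℕ → ExpPoly K) (a : K)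
    (P : MvPolynomial σ K) :
    eval a (aeval (fun i => expVars (ExpPoly.X K) f (j i)) P) =
      aeval (fun i => valuesAt f a (j i)) P :=
  comp_aeval_apply _ (evalₐ a) P

/-- A polynomial in `x, v₀, …, vₙ₋₁` that is the product of a polynomial in `x` and a monomial in
the `vᵢ`. -/
def IsSplit {n : ℕ} (P : MvPolynomial (Fin (n + 1)) K) : Prop :=
  ∃ (R : Polynomial K) (e : Fin n → ℕ),
    P = Polynomial.aeval (X 0 : MvPolynomial (Fin (n + 1)) K) R * ∏ i, X i.succ ^ e i

/-- The statement that only split polynomials have finitely many zeros on the graph of the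
exponentials `exp f₀, …, exp fₙ₋₁`. -/
def FiniteZerosSplit (f : ℕ → ExpPoly K) (n : ℕ) : Prop :=
  ∀ P : MvPolynomial (Fin (n + 1)) K, P ≠ 0 →
    {a : K | aeval (fun j : Fin (n + 1) => valuesAt f a j) P = 0}.Finite → IsSplit P

theorem aeval_valuesAt_split {n : ℕ} (f : ℕ → ExpPoly K) (a : K) (R : Polynomial K)
    (e : Fin n → ℕ) :
    aeval (fun j : Fin (n + 1) => valuesAt f a j)
      (Polynomial.aeval (X 0 : MvPolynomial (Fin (n + 1)) K) R * ∏ i, X i.succ ^ e i) =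
      R.eval a * ∏ i : Fin n, valuesAt f a (i + 1) ^ e i := by
  rw [map_mul, map_prod, ← Polynomial.aeval_algHom_apply, aeval_X]
  simp [valuesAt_zero, Polynomial.aeval_def, Polynomial.eval₂_eq_eval_map]

theorem aeval_valuesAt_split_eq_zero_iff {n : ℕ} (f : ℕ → ExpPoly K) (a : K) (R : Polynomial K)
    (e : Fin n → ℕ) :
    aeval (fun j : Fin (n + 1) => valuesAt f a j)
      (Polynomial.aeval (X 0 : MvPolynomial (Fin (n + 1)) K) R * ∏ i, X i.succ ^ e i) = 0 ↔
      R.eval a = 0 := by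
  rw [aeval_valuesAt_split, mul_eq_zero, or_iff_left]
  exact Finset.prod_ne_zero_iff.2 fun i _ => pow_ne_zero _ (valuesAt_succ_ne_zero f a i)

/-- A polynomial without zeros on the graph of the exponentials is a constant times a monomial in
the exponentials. -/
theorem FiniteZerosSplit.exists_of_forall_ne_zero [IsAlgClosed K] {f : ℕ → ExpPoly K} {n : ℕ}
    (h : FiniteZerosSplit f n) {P : MvPolynomial (Fin (n + 1)) K}
    (hP : ∀ a : K, aeval (fun j : Fin (n + 1) => valuesAt f a j) P ≠ 0) :
    ∃ (κ : K) (e : Fin n → ℕ), κ ≠ 0 ∧ P = C κ * ∏ i, X i.succ ^ e i := by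
  have hP0 : P ≠ 0 := fun h0 => hP 0 (by rw [h0, map_zero])
  have hempty : {a : K | aeval (fun j : Fin (n + 1) => valuesAt f a j) P = 0} = ∅ :=
    Set.eq_empty_of_forall_notMem hP
  obtain ⟨R, e, rfl⟩ := h P hP0 (hempty ▸ Set.finite_empty)
  have hR : ∀ a, R.eval a ≠ 0 := fun a ha =>
    hP a ((aeval_valuesAt_split_eq_zero_iff f a R e).2 ha)
  have hdeg : R.degree = 0 := by
    by_contra hd
    obtain ⟨a, ha⟩ := IsAlgClosed.exists_root R hd
    exact hR a ha
  rw [Polynomial.eq_C_of_degree_eq_zero hdeg] at hR ⊢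
  exact ⟨R.coeff 0, e, by simpa using hR 0, by rw [Polynomial.aeval_C]; rfl⟩

theorem FiniteZerosSplit.exists_monomial [IsAlgClosed K] {f : ℕ → ExpPoly K} {n : ℕ}
    (h : FiniteZerosSplit f n) {P : MvPolynomial (Fin (n + 1)) K}
    (hP : ∀ a : K, aeval (fun j : Fin (n + 1) => valuesAt f a j) P ≠ 0) :
    ∃ (κ : K) (s : Fin (n + 1) →₀ ℕ), κ ≠ 0 ∧ P = monomial s κ := by
  obtain ⟨κ, e, hκ, rfl⟩ := h.exists_of_forall_ne_zero hP
  obtain ⟨s, hs⟩ : ∃ s, (∏ i : Fin n, X i.succ ^ e i : MvPolynomial (Fin (n + 1)) K) =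
      monomial s 1 := by
    refine Finset.prod_induction _ (fun q => ∃ s, q = monomial s 1) ?_ ⟨0, rfl⟩ ?_
    · rintro _ _ ⟨s, rfl⟩ ⟨t, rfl⟩
      exact ⟨s + t, by rw [monomial_mul, one_mul]⟩
    · exact fun i _ => ⟨_, X_pow_eq_monomial⟩
  exact ⟨κ, s, hκ, by rw [hs, C_mul_monomial, mul_one]⟩

/-- A nonconstant element of the level `n` omits at most one value. -/
theorem FiniteZerosSplit.eq_of_forall_ne [IsAlgClosed K] {f : ℕ → ExpPoly K} {n : ℕ}
    (hM : FiniteZerosSplit f n) {h : ExpPoly K} (hh : h ∈ level f n)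
    (hnc : ∀ c : K, h ≠ algebraMap K _ c) {c c' : K} (hc : ∀ a, eval a h ≠ c)
    (hc' : ∀ a, eval a h ≠ c') : c = c' := by
  by_contra hne
  obtain ⟨P, Q, hQ, hPQ⟩ := hh
  have hQa (a : K) : aeval (fun j : Fin (n + 1) => valuesAt f a j) Q ≠ 0 := by
    rw [← eval_aeval_expVars]
    exact (hQ.map (eval a)).ne_zero
  have hPa (a : K) : aeval (fun j : Fin (n + 1) => valuesAt f a j) P =
      aeval (fun j : Fin (n + 1) => valuesAt f a j) Q * eval a h := by
    rw [← eval_aeval_expVars, ← eval_aeval_expVars, ← map_mul, hPQ]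
  have hsub {c : K} (hc : ∀ a, eval a h ≠ c) (a : K) :
      aeval (fun j : Fin (n + 1) => valuesAt f a j) (P - C c * Q) ≠ 0 := by
    rw [map_sub, map_mul, aeval_C, hPa, mul_comm, ← sub_mul]
    exact mul_ne_zero (sub_ne_zero.2 (hc a)) (hQa a)
  obtain ⟨k₀, s₀, hk₀, h₀⟩ := hM.exists_monomial hQa
  obtain ⟨k₁, s₁, hk₁, h₁⟩ := hM.exists_monomial (hsub hc)
  obtain ⟨k₂, s₂, hk₂, h₂⟩ := hM.exists_monomial (hsub hc')
  have hs : s₀ = s₁ := by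
    refine eq_of_monomial_add_monomial_eq (k₀ := (c' - c) * k₀) (k₂ := k₂) (s₂ := s₂)
      (mul_ne_zero (sub_ne_zero.2 (Ne.symm hne)) hk₀) hk₁ ?_
    rw [← C_mul_monomial, ← h₀, ← h₁, ← h₂, C_sub]
    ring
  have hP : P = C (c + k₁ / k₀) * Q := by
    have h3 : monomial s₁ k₁ = C (k₁ / k₀) * Q := by
      rw [h₀, C_mul_monomial, div_mul_cancel₀ _ hk₀, hs]
    rw [C_add, add_mul, ← h3, ← h₁]
    ring
  refine hnc (c + k₁ / k₀) (hQ.mul_left_cancel ?_)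
  rw [hPQ, hP, map_mul, aeval_C, mul_comm]

/-- For `h` nonconstant in the level `n`, the equation `exp h = β` has infinitely many
solutions. -/
theorem FiniteZerosSplit.infinite_expU_eq [IsAlgClosed K]
    (hsurj : Function.Surjective (expU : K → Kˣ)) (hker : {x : K | expU x = 1}.Infinite)
    {f : ℕ → ExpPoly K} {n : ℕ}
    (hM : FiniteZerosSplit f n) {h : ExpPoly K} (hh : h ∈ level f n)
    (hnc : ∀ c : K, h ≠ algebraMap K _ c) (β : Kˣ) :
    {a : K | expU (eval a h) = β}.Infinite := by
  intro hfin
  obtain ⟨c₀, hc₀⟩ := hsurj β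
  have hD : {c : K | expU c = β}.Infinite := by
    refine Set.infinite_of_injOn_mapsTo (f := fun x => c₀ + x) (add_right_injective c₀).injOn ?_
      hker
    intro x hx
    change expU (c₀ + x) = β
    rw [expU_add, hc₀, show expU x = 1 from hx, mul_one]
  -- all but finitely many logarithms of `β` are omitted values of `h`
  have hdiff := hD.sdiff (hfin.image fun a => eval a h)
  obtain ⟨c, hc, c', hc', hne⟩ := hdiff.nontrivial
  have homit {c : K} (hc : c ∈ {c : K | expU c = β} \
      (fun a => eval a h) '' {a : K | expU (eval a h) = β}) (a : K) : eval a h ≠ c :=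
    fun hac => hc.2 ⟨a, by rw [Set.mem_ofPred_eq, hac]; exact hc.1, hac⟩
  exact hne (hM.eq_of_forall_ne hh hnc (homit hc) (homit hc'))

end Split

/-! ### Zeros from existential closedness -/

section Generic

variable {K : Type u} [Field K] [CharZero K] [ERing K]

open ExpPoly (eval evalₐ)

variable {E : Type u} [Field E] [Algebra K E] {n : ℕ} {f : ℕ → ExpPoly K} {z : Fin (n + 2) → E}

/-- Evaluating the terms of a tower at a generic point: `u j` is the value of the rational function
`f j` at the algebraically independent point `z 0, …, z j`. The value `u 0` is normalized
explicitly, as the representation of `f 0` by a fraction is not shown to be unique. -/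
theorem IsTower.exists_generic (hf : IsTower f (n + 1))
    (hz : AlgebraicIndependent K fun i : Fin (n + 1) => z i.castSucc) {κ : K}
    (hκ : f 0 = κ • ExpPoly.X K) :
    ∃ u : Fin (n + 1) → E, u 0 = κ • z 0 ∧ ∀ j : Fin (n + 1), (u j, f j) ∈
      unitFrac K (fun i : Fin ((j : ℕ) + 1) =>
        (z ⟨i, by omega⟩, expVars (ExpPoly.X K) f i)) := by
  have hex (j : Fin (n + 1)) : ∃ e : E, (j = 0 → e = κ • z 0) ∧ (e, f j) ∈
      unitFrac K (fun i : Fin ((j : ℕ) + 1) =>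
        (z ⟨i, by omega⟩, expVars (ExpPoly.X K) f i)) := by
    by_cases hj : j = 0
    · subst hj
      refine ⟨κ • z 0, fun _ => rfl, ?_⟩
      have : ((κ • z 0, f (0 : Fin (n + 1))) : E × ExpPoly K) = κ • (z 0, ExpPoly.X K) :=
        Prod.ext rfl hκ
      rw [this]
      exact Subalgebra.smul_mem _ (apply_mem_unitFrac (fun i : Fin (0 + 1) =>
        ((z ⟨i, by omega⟩, expVars (ExpPoly.X K) f i) : E × ExpPoly K)) 0) κ
    · have hj' : AlgebraicIndependent K (fun i : Fin ((j : ℕ) + 1) => z ⟨i, by omega⟩) :=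
        hz.comp (fun i : Fin ((j : ℕ) + 1) => (⟨i, by omega⟩ : Fin (n + 1)))
          (fun a b hab => Fin.ext (Fin.mk.inj hab))
      obtain ⟨e, he⟩ := exists_prodMk_mem_unitFrac hj' (hf.mem j j.2)
      exact ⟨e, fun h => absurd h hj, he⟩
  choose u hu0 hu using hex
  exact ⟨u, hu0 0 rfl, hu⟩

/-- No nontrivial rational combination of the values of a tower at a generic point is constant. -/
theorem IsTower.generic_indep (hf : IsTower f (n + 1))
    (hz : AlgebraicIndependent K fun i : Fin (n + 1) => z i.castSucc) {u : Fin (n + 1) → E}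
    (hu : ∀ j : Fin (n + 1), (u j, f j) ∈ unitFrac K (fun i : Fin ((j : ℕ) + 1) =>
        (z ⟨i, by omega⟩, expVars (ExpPoly.X K) f i)))
    (w : Fin (n + 1) → ℚ) (hw : w ≠ 0) (c : K) : ∑ j, (w j : E) * u j ≠ algebraMap K E c := by
  have : CharZero E := charZero_of_injective_algebraMap (algebraMap K E).injective
  intro h
  refine hw (hf.indep w c (eq_algebraMap_of_prodMk_mem_unitFrac hz
    (z := fun i : Fin (n + 1) => expVars (ExpPoly.X K) f i) ?_))
  have hsum : ((algebraMap K E c, ∑ j : Fin (n + 1), ((w j : ℚ) : K) • f j) : E × ExpPoly K) =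
      ∑ j : Fin (n + 1), ((w j : ℚ) : K) • (u j, f j) := by
    refine Prod.ext ?_ ?_
    · refine (h.symm.trans (Finset.sum_congr rfl fun j _ => ?_)).trans
        (Prod.fst_sum (s := Finset.univ)
          (f := fun j : Fin (n + 1) => (((w j : ℚ) : K) • (u j, f j) : E × ExpPoly K))).symm
      rw [Prod.smul_fst, Algebra.smul_def, map_ratCast]
    · exact (Prod.snd_sum (s := Finset.univ)
        (f := fun j : Fin (n + 1) => (((w j : ℚ) : K) • (u j, f j) : E × ExpPoly K))).symm
  rw [hsum]
  refine sum_mem fun j _ => Subalgebra.smul_mem _ (unitFrac_le (fun i => ?_) (hu j)) _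
  exact apply_mem_unitFrac (fun i : Fin (n + 1) =>
    ((z i.castSucc, expVars (ExpPoly.X K) f i) : E × ExpPoly K)) ⟨i, by omega⟩

/-- A point of the locus of a generic point of the tower whose multiplicative part is the
exponential of its additive part `a` has `aⱼ = fⱼ(x₀)` for `x₀ = a₀ / κ`, and satisfies at `x₀` all
the polynomial relations of the generic point. -/
theorem IsTower.of_mem_locus {κ : K} (hκ0 : κ ≠ 0) (hv0 : ∀ j : Fin (n + 1), z j.succ ≠ 0)
    {u : Fin (n + 1) → E} (hu0 : u 0 = κ • z 0)
    (hu : ∀ j : Fin (n + 1), (u j, f j) ∈ unitFrac K (fun i : Fin ((j : ℕ) + 1) =>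
        (z ⟨i, by omega⟩, expVars (ExpPoly.X K) f i)))
    {a : Fin (n + 1) → K} (ha : ((a, fun i => expU (a i)) : GPoint K (n + 1)) ∈
      locus K u (fun j => Units.mk0 (z j.succ) (hv0 j))) :
    (∀ j : Fin (n + 1), a j = eval (κ⁻¹ * a 0) (f j)) ∧
      ∀ P : MvPolynomial (Fin (n + 2)) K, aeval z P = 0 →
        aeval (fun j : Fin (n + 2) => valuesAt f (κ⁻¹ * a 0) j) P = 0 := by
  -- the coordinate functions on `G_{n+1}` whose values at the generic point are the `z i`
  let θ : Fin (n + 2) → MvPolynomial (Fin (n + 1) ⊕ Fin (n + 1)) K :=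
    Fin.cases (C κ⁻¹ * X (Sum.inl 0)) (fun j => X (Sum.inr j))
  have hθz (i : Fin (n + 2)) :
      aeval (Sum.elim u fun j => (Units.mk0 (z j.succ) (hv0 j) : E)) (θ i) = z i := by
    refine Fin.cases ?_ (fun j => ?_) i
    · simp only [θ, Fin.cases_zero, map_mul, aeval_C, aeval_X, Sum.elim_inl, hu0]
      rw [← Algebra.smul_def, inv_smul_smul₀ hκ0]
    · simp [θ]
  set x₀ := κ⁻¹ * a 0 with hx₀
  have hθ0 : MvPolynomial.eval (coords (a, fun i => expU (a i))) (θ 0) = x₀ := by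
    simp [θ, coords, hx₀]
  have hθs (j : Fin (n + 1)) :
      MvPolynomial.eval (coords (a, fun i => expU (a i))) (θ j.succ) = (expU (a j) : Kˣ) := by
    simp [θ, coords]
  have hcomp {σ : Type} (i : σ → Fin (n + 2)) (P : MvPolynomial σ K) :
      aeval (Sum.elim u fun j => (Units.mk0 (z j.succ) (hv0 j) : E))
        (aeval (fun s => θ (i s)) P) = aeval (fun s => z (i s)) P := by
    rw [comp_aeval_apply]
    simp only [hθz]
  have hcomp' {σ : Type} (i : σ → Fin (n + 2)) (P : MvPolynomial σ K)
      (hi : ∀ s, MvPolynomial.eval (coords (a, fun i => expU (a i))) (θ (i s)) =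
        valuesAt f x₀ (i s)) :
      MvPolynomial.eval (coords (a, fun i => expU (a i))) (aeval (fun s => θ (i s)) P) =
        aeval (fun s => valuesAt f x₀ (i s)) P := by
    have := comp_aeval_apply (fun s => θ (i s)) (aeval (coords (a, fun i => expU (a i)))) P
    refine this.trans ?_
    congr 2
    exact funext hi
  have ha' : ∀ j : Fin (n + 1), a j = eval x₀ (f j) := by
    intro j
    obtain ⟨j, hj⟩ := j
    induction j using Nat.strong_induction_on with
    | _ j ih =>
      obtain ⟨P, Q, hQ, hPQ⟩ := hu ⟨j, hj⟩
      rw [aeval_prodMk, Prod.isUnit_iff] at hQ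
      rw [aeval_prodMk, aeval_prodMk, Prod.mk_mul_mk, Prod.mk.injEq] at hPQ
      let i : Fin (j + 1) → Fin (n + 2) := fun s => ⟨s, by omega⟩
      have hi (s : Fin (j + 1)) : MvPolynomial.eval (coords (a, fun i => expU (a i))) (θ (i s)) =
          valuesAt f x₀ (i s) := by
        obtain ⟨_ | s, hs⟩ := s
        · exact hθ0.trans (valuesAt_zero f x₀).symm
        · have h1 := hθs ⟨s, by omega⟩
          rw [ih s (by omega) (by omega)] at h1
          exact h1.trans (valuesAt_succ f x₀ s).symm
      -- the relation `Q(z) * u j = P(z)` holds on the locus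
      have h1 := ha (aeval (fun s => θ (i s)) Q * X (Sum.inl ⟨j, hj⟩) - aeval (fun s => θ (i s)) P)
        (by
          rw [map_sub, map_mul, hcomp, hcomp, aeval_X, sub_eq_zero]
          exact hPQ.1)
      rw [map_sub, map_mul, hcomp' i Q hi, hcomp' i P hi, eval_X, sub_eq_zero] at h1
      have h2 := congrArg (eval x₀) hPQ.2
      rw [map_mul, eval_aeval_expVars, eval_aeval_expVars] at h2
      have h3 : aeval (fun s : Fin (j + 1) => valuesAt f x₀ s) Q ≠ 0 := by
        rw [← eval_aeval_expVars]
        exact (hQ.2.map (eval x₀)).ne_zero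
      exact mul_left_cancel₀ h3 (h1.trans h2.symm)
  refine ⟨ha', fun P hP => ?_⟩
  have h1 := ha (aeval (fun s => θ s) P) ((hcomp id P).trans hP)
  refine (hcomp' id P fun s => ?_).symm.trans h1
  refine Fin.cases ?_ (fun j => ?_) s
  · exact hθ0.trans (valuesAt_zero f x₀).symm
  · refine (hθs j).trans ?_
    rw [ha' j]
    exact (valuesAt_succ f x₀ j).symm

/-- If the exponentials of a tower satisfy no multiplicative relation at a generic point of the
hypersurface `P = 0`, existential closedness gives infinitely many zeros of `P`. -/
theorem IsTower.infinite_zeros_of_forall_ne [IsAlgClosed K] (hEC : IsExistentiallyClosed K)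
    (hf : IsTower f (n + 1))
    (hz : IsTranscendenceBasis K fun i : Fin (n + 1) => z i.castSucc)
    (hv0 : ∀ j : Fin (n + 1), z j.succ ≠ 0) {P : MvPolynomial (Fin (n + 2)) K}
    (hP : aeval z P = 0)
    (hrel : ∀ m : Fin (n + 1) → ℤ, m ≠ 0 → ∀ b : K,
      ((∏ i, Units.mk0 (z i.succ) (hv0 i) ^ m i : Eˣ) : E) ≠ algebraMap K E b) :
    {a : K | aeval (fun j : Fin (n + 2) => valuesAt f a j) P = 0}.Infinite := by
  obtain ⟨κ, hκ0, hκ⟩ := hf.base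
  obtain ⟨u, hu0, hu⟩ := hf.exists_generic hz.1 hκ
  have hind := hf.generic_indep hz.1 hu
  have hrot : IsRotund (locus K u fun j => Units.mk0 (z j.succ) (hv0 j)) := by
    refine isRotund_locus hz (fun j h => rfl) (fun j => ?_) hind
    refine unitFrac_le (fun i => ?_) (map_mem_unitFrac (AlgHom.fst K E (ExpPoly K)) (hu j))
    exact apply_mem_unitFrac (fun i : Set.Iic j => z (i : Fin (n + 1)).castSucc)
      ⟨⟨i, by omega⟩, Nat.le_of_lt_succ i.2⟩
  have hfree : IsFree (locus K u fun j => Units.mk0 (z j.succ) (hv0 j)) := by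
    refine isFree_locus (fun m hm b => ?_) hrel
    have := hind (fun j => (m j : ℚ)) (fun h => hm (funext fun j => by
      simpa using congrFun h j)) b
    simpa using this
  refine Set.infinite_of_injOn_mapsTo (f := fun a : Fin (n + 1) → K => κ⁻¹ * a 0) ?_ ?_
    (hEC (n + 1) _ (Nat.le_add_left 1 n) isIrreducibleVariety_locus hrot hfree)
  · intro a ha b hb hab
    ext j
    rw [(IsTower.of_mem_locus hκ0 hv0 hu0 hu ha).1 j, (IsTower.of_mem_locus hκ0 hv0 hu0 hu hb).1 j]
    exact congrArg (fun x => eval x (f j)) hab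
  · exact fun a ha => (IsTower.of_mem_locus hκ0 hv0 hu0 hu ha).2 P hP

end Generic

/-! ### Multiplicative relations at a generic point -/

section Relation

variable {K E : Type u} [Field K] [Field E] [Algebra K E]

theorem exists_units_zpow_eq [IsAlgClosed E] (x : Eˣ) {N : ℤ} (hN : N ≠ 0) :
    ∃ t : Eˣ, t ^ N = x := by
  obtain ⟨t, ht⟩ := IsAlgClosed.exists_pow_nat_eq (x : E) (Int.natAbs_pos.2 hN)
  have ht0 : t ≠ 0 := by
    rintro rfl
    rw [zero_pow (Int.natAbs_pos.2 hN).ne'] at ht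
    exact x.ne_zero ht.symm
  have hu : Units.mk0 t ht0 ^ N.natAbs = x := Units.ext (by simpa using ht)
  rcases Int.natAbs_eq N with h | h
  · exact ⟨Units.mk0 t ht0, by rw [h, zpow_natCast, hu]⟩
  · exact ⟨(Units.mk0 t ht0)⁻¹, by rw [h, zpow_neg, inv_zpow, inv_inv, zpow_natCast, hu]⟩

theorem isAlgebraic_of_units_zpow {A : Type*} [CommRing A] [Algebra A E] [IsDomain A] {x : Eˣ}
    {N : ℤ} (hN : N ≠ 0) (h : IsAlgebraic A ((x ^ N : Eˣ) : E)) : IsAlgebraic A (x : E) := by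
  refine IsAlgebraic.of_pow (n := N.natAbs) (Int.natAbs_pos.2 hN) ?_
  rcases Int.natAbs_eq N with h' | h'
  · rw [h', zpow_natCast] at h
    simpa using h
  · rw [h', zpow_neg, zpow_natCast] at h
    simpa using h.inv

section UnitPair

variable {E K : Type*} [Field E] [Field K]

/-- The pair of a unit of `E` and a unit of `K` as a unit of the product. -/
def unitPair (x : Eˣ) (c : Kˣ) : (E × K)ˣ := MulEquiv.prodUnits.symm (x, c)

theorem val_unitPair (x : Eˣ) (c : Kˣ) : (unitPair x c : E × K) = ((x : E), (c : K)) := rfl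

theorem unitPair_zpow (x : Eˣ) (c : Kˣ) (m : ℤ) :
    unitPair x c ^ m = unitPair (x ^ m) (c ^ m) :=
  (map_zpow MulEquiv.prodUnits.symm (x, c) m).symm

theorem unitPair_inv (x : Eˣ) (c : Kˣ) : (unitPair x c)⁻¹ = unitPair x⁻¹ c⁻¹ :=
  (map_inv MulEquiv.prodUnits.symm (x, c)).symm

theorem prod_unitPair {ι : Type*} (s : Finset ι) (x : ι → Eˣ) (c : ι → Kˣ) :
    ∏ i ∈ s, unitPair (x i) (c i) = unitPair (∏ i ∈ s, x i) (∏ i ∈ s, c i) := by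
  refine Units.ext (Prod.ext ?_ ?_)
  · simp [Prod.fst_prod, val_unitPair]
  · simp [Prod.snd_prod, val_unitPair]

end UnitPair

/-- Algebraically independent units are multiplicatively independent modulo constants. -/
theorem eq_zero_of_prod_zpow_eq_algebraMap [CharZero K] {ι : Type*} [Fintype ι] {v : ι → Eˣ}
    (hv : AlgebraicIndependent K fun i => (v i : E)) {m : ι → ℤ} {b : K}
    (h : ((∏ i, v i ^ m i : Eˣ) : E) = algebraMap K E b) : m = 0 := by
  classical
  -- the relation holds at every point of the torus, in particular at `1` and at `(1, …, 2, …, 1)`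
  have key (c : ι → Kˣ) : ((∏ i, c i ^ m i : Kˣ) : K) = b := by
    have h1 := units_prod_zpow_mem_unitFrac (K := K) (z := fun i => ((v i : E), (c i : K)))
      Finset.univ (s := fun i => unitPair (v i) (c i)) (fun i _ => apply_mem_unitFrac _ i) m
    simp only [unitPair_zpow] at h1
    rw [prod_unitPair, val_unitPair, h] at h1
    exact eq_algebraMap_of_prodMk_mem_unitFrac hv h1
  have hb : 1 = b := by simpa using key 1
  ext j
  have h2 := key (Function.update 1 j (Units.mk0 2 two_ne_zero))
  rw [Finset.prod_eq_single j (fun i _ hi => by rw [Function.update_of_ne hi]; simp)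
    (fun hj => absurd (Finset.mem_univ j) hj), Function.update_self, ← hb,
    Units.val_zpow_eq_zpow_val, Units.val_mk0] at h2
  have h3 : (2 : ℚ) ^ m j = 1 := Rat.cast_injective (α := K) (by push_cast; exact h2)
  exact (zpow_eq_one_iff_right₀ (by norm_num) (by norm_num)).1 h3

open AlgebraicIndependent (matroid) in
/-- A family over which a finite transcendence basis of the same size is algebraic is again a
transcendence basis. -/
theorem isTranscendenceBasis_of_subset_closure {ι : Type*} [Finite ι] {y y' : ι → E}
    (hy : IsTranscendenceBasis K y) (h : ∀ i, IsAlgebraic (Algebra.adjoin K (Set.range y')) (y i)) :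
    IsTranscendenceBasis K y' := by
  have hsp : (matroid K E).Spanning (Set.range y') := by
    rw [← Matroid.closure_spanning_iff (Set.subset_univ _)]
    have h1 : (matroid K E).Spanning (Set.range y) :=
      AlgebraicIndependent.matroid_spanning_iff.2 hy.isAlgebraic
    refine h1.superset ?_ (Set.subset_univ _)
    rintro _ ⟨i, rfl⟩
    exact mem_matroid_closure_iff.2 (h i)
  have := AlgebraicIndependent.matroid_spanning_iff.1 hsp
  exact Algebra.IsAlgebraic.isTranscendenceBasis_of_lift_le_trdeg_of_finite K y'
    hy.lift_cardinalMk_eq_trdeg.le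

end Relation

section Zeros

variable {K : Type u} [Field K] [CharZero K] [ERing K]

open ExpPoly (eval evalₐ)

section Generic

variable {E : Type u} [Field E] [Algebra K E] {n : ℕ} {f : ℕ → ExpPoly K} {z : Fin (n + 2) → E}

/-- If the exponentials of a tower satisfy a multiplicative relation at a generic point of the
hypersurface `P = 0`, then `P` vanishes wherever `exp h = β`, for a nonconstant rational combination
`h` of the tower and a constant `β`; this happens at infinitely many points. -/
theorem IsTower.infinite_zeros_of_prod_eq [IsAlgClosed K] [IsAlgClosed E]
    (hsurj : Function.Surjective (expU : K → Kˣ)) (hker : {x : K | expU x = 1}.Infinite)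
    (hM : FiniteZerosSplit f n) (hf : IsTower f (n + 1))
    (hz : IsTranscendenceBasis K fun i : Fin (n + 1) => z i.castSucc)
    (hv0 : ∀ j : Fin (n + 1), z j.succ ≠ 0) {P : MvPolynomial (Fin (n + 2)) K}
    (hP : aeval z P = 0) {m : Fin (n + 1) → ℤ} (hm : m ≠ 0) {b : K}
    (hb : ((∏ i, Units.mk0 (z i.succ) (hv0 i) ^ m i : Eˣ) : E) = algebraMap K E b) :
    {a : K | aeval (fun j : Fin (n + 2) => valuesAt f a j) P = 0}.Infinite := by
  set v : Fin (n + 1) → Eˣ := fun i => Units.mk0 (z i.succ) (hv0 i) with hv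
  set N := m (Fin.last n) with hNdef
  rw [Fin.prod_univ_castSucc] at hb
  have hN : N ≠ 0 := by
    intro h0
    rw [← hNdef, h0, zpow_zero, mul_one] at hb
    have h1 : AlgebraicIndependent K fun i : Fin n => (v i.castSucc : E) :=
      hz.1.comp (fun i : Fin n => i.succ) (Fin.succ_injective n)
    have h2 := eq_zero_of_prod_zpow_eq_algebraMap h1 hb
    refine hm (funext fun i => ?_)
    refine Fin.lastCases h0 (fun i => congrFun h2 i) i
  -- after extracting roots, the relation expresses the last variable by the others
  choose t ht using fun i : Fin n => exists_units_zpow_eq (v i.castSucc) hN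
  set s : Eˣ := v (Fin.last n) * ∏ i : Fin n, t i ^ m i.castSucc with hs
  have hsN : ((s ^ N : Eˣ) : E) = algebraMap K E b := by
    rw [← hb, hs, mul_zpow, mul_comm, ← Finset.prod_zpow]
    congr 2
    refine Finset.prod_congr rfl fun i _ => ?_
    rw [← zpow_mul, mul_comm, zpow_mul, ht]
  obtain ⟨β₀, hβ₀⟩ : ∃ β₀ : K, algebraMap K E β₀ = s := by
    have halg : IsAlgebraic K (s : E) :=
      isAlgebraic_of_units_zpow hN (hsN ▸ isAlgebraic_algebraMap b)
    exact minpoly.mem_range_of_degree_eq_one K (s : E)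
      (IsAlgClosed.degree_eq_one_of_irreducible K (minpoly.irreducible halg.isIntegral))
  have hβ0 : β₀ ≠ 0 := by
    rintro rfl
    rw [map_zero] at hβ₀
    exact s.ne_zero hβ₀.symm
  set β : Kˣ := Units.mk0 β₀ hβ0 with hβ
  let y' : Fin (n + 1) → E := Fin.cons (z 0) (fun i => (t i : E))
  have hy' : IsTranscendenceBasis K y' := by
    refine isTranscendenceBasis_of_subset_closure hz fun i => ?_
    have hmem (i) : IsAlgebraic (Algebra.adjoin K (Set.range y')) (y' i) :=
      isAlgebraic_algebraMap (⟨y' i, Algebra.subset_adjoin ⟨i, rfl⟩⟩ :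
        Algebra.adjoin K (Set.range y'))
    refine Fin.cases (hmem 0) (fun i => ?_) i
    have h1 : z i.succ.castSucc = ((t i ^ N : Eˣ) : E) := by
      rw [ht]
      rfl
    have h2 : (t i : E) = y' i.succ := rfl
    rw [h1]
    rcases Int.natAbs_eq N with h' | h'
    · rw [h', zpow_natCast, Units.val_pow_eq_pow_val, h2]
      exact (hmem _).pow _
    · rw [h', zpow_neg, zpow_natCast, Units.val_inv_eq_inv_val, Units.val_pow_eq_pow_val, h2]
      exact ((hmem _).pow _).inv
  have hNK : (N : K) ≠ 0 := Int.cast_ne_zero.2 hN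
  let h : ExpPoly K := f n + ∑ i : Fin n, ((m i.castSucc : K) * (N : K)⁻¹) • f i
  have hh : h ∈ level f n :=
    add_mem (hf.mem n (Nat.lt_succ_self n)) (sum_mem fun i _ => Subalgebra.smul_mem _
      (level_mono f i.2.le (hf.mem i (by omega))) _)
  have hnc (c : K) : h ≠ algebraMap K _ c := by
    intro hc
    have h1 := hf.indep (Fin.snoc (fun i : Fin n => (m i.castSucc : ℚ) * (N : ℚ)⁻¹) 1) c (by
      rw [← hc, Fin.sum_univ_castSucc]
      simp [h, add_comm])
    have h2 := congrFun h1 (Fin.last n)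
    rw [Fin.snoc_last] at h2
    exact one_ne_zero h2
  refine (hM.infinite_expU_eq hsurj hker hh hnc β).mono fun a ha => ?_
  -- the roots of the values of the exponentials that correspond to the `t i`
  let τ : Fin n → Kˣ := fun i => expU ((N : K)⁻¹ * eval a (f i))
  have hτ (i : Fin n) : τ i ^ N = expU (eval a (f i)) := by
    rw [← expU_zsmul, zsmul_eq_mul, mul_inv_cancel_left₀ hNK]
  have hlast : expU (eval a (f n)) = β * (∏ i, τ i ^ m i.castSucc)⁻¹ := by
    have h1 : eval a h = eval a (f n) + ∑ i : Fin n, m i.castSucc • ((N : K)⁻¹ * eval a (f i)) := by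
      change evalₐ a h = evalₐ a (f n) + ∑ i : Fin n, m i.castSucc • ((N : K)⁻¹ * evalₐ a (f i))
      simp [h, mul_assoc]
    have h2 : expU (eval a h) = β := ha
    rw [h1, expU_add, expU_sum] at h2
    simp only [expU_zsmul] at h2
    exact eq_mul_inv_of_mul_eq h2
  let pt : Fin (n + 1) → E × K := fun i => (y' i, (Fin.cons a (fun i => (τ i : K)) : _ → K) i)
  have htτ (i : Fin n) (k : ℤ) : ((unitPair (t i) (τ i) ^ k : (E × K)ˣ) : E × K) ∈ unitFrac K pt :=
    units_zpow_mem_unitFrac (apply_mem_unitFrac pt i.succ) k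
  have hmem (i : Fin (n + 2)) : (z i, valuesAt f a i) ∈ unitFrac K pt := by
    refine Fin.cases ?_ (fun i => Fin.lastCases ?_ (fun i => ?_) i) i
    · have := apply_mem_unitFrac (K := K) pt 0
      exact (valuesAt_zero f a).symm ▸ this
    · have h1 : (z (Fin.last n).succ, valuesAt f a ((Fin.last n).succ : Fin (n + 2))) =
          algebraMap K (E × K) β₀ *
            ((∏ i, unitPair (t i) (τ i) ^ m i.castSucc : (E × K)ˣ)⁻¹ : (E × K)ˣ) := by
        simp only [unitPair_zpow]
        rw [prod_unitPair, unitPair_inv, val_unitPair]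
        refine Prod.ext ?_ ?_
        · change (v (Fin.last n) : E) = algebraMap K E β₀ * _
          rw [hβ₀, ← Units.val_mul, hs, mul_inv_cancel_right]
        · refine (valuesAt_succ f a n).trans ?_
          rw [hlast]
          rfl
      rw [h1]
      refine mul_mem (Subalgebra.algebraMap_mem _ _) (units_inv_mem_unitFrac ?_)
      rw [Units.coe_prod]
      exact prod_mem fun i _ => htτ i _
    · have h1 : (z i.castSucc.succ, valuesAt f a (i.castSucc.succ : Fin (n + 2))) =
          ((unitPair (t i) (τ i) ^ N : (E × K)ˣ) : E × K) := by
        rw [unitPair_zpow, val_unitPair, ht, hτ]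
        exact Prod.ext rfl (valuesAt_succ f a i)
      exact h1 ▸ htτ i N
  have h1 := aeval_mem_of_forall_mem hmem P
  rw [aeval_prodMk, hP, ← map_zero (algebraMap K E)] at h1
  exact (eq_algebraMap_of_prodMk_mem_unitFrac hy'.1 h1)

end Generic

/-! ### Zeros of polynomials in the exponentials of a tower -/

/-- There is an algebraically closed extension of `K` with a transcendence basis of size `n`. -/
theorem exists_isAlgClosed_isTranscendenceBasis (K : Type u) [Field K] (n : ℕ) :
    ∃ (E : Type u) (_ : Field E) (_ : Algebra K E) (y : Fin n → E),
      IsAlgClosed E ∧ IsTranscendenceBasis K y := by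
  let F := FractionRing (MvPolynomial (Fin n) K)
  have : Algebra.IsAlgebraic (MvPolynomial (Fin n) K) F :=
    IsLocalization.isAlgebraic _ (nonZeroDivisors (MvPolynomial (Fin n) K))
  have : Algebra.IsAlgebraic (MvPolynomial (Fin n) K) (AlgebraicClosure F) :=
    Algebra.IsAlgebraic.trans _ F _
  have : FaithfulSMul (MvPolynomial (Fin n) K) (AlgebraicClosure F) :=
    (faithfulSMul_iff_algebraMap_injective _ _).2 (by
      rw [IsScalarTower.algebraMap_eq (MvPolynomial (Fin n) K) F (AlgebraicClosure F)]
      exact (algebraMap F (AlgebraicClosure F)).injective.comp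
        (IsFractionRing.injective (MvPolynomial (Fin n) K) F))
  exact ⟨AlgebraicClosure F, inferInstance, inferInstance, _, inferInstance,
    (IsTranscendenceBasis.mvPolynomial (Fin n) K).algebraMap_comp⟩

/-- A polynomial that involves the last exponential of a tower and is not divisible by it has
infinitely many zeros. -/
theorem IsTower.infinite_zeros [IsAlgClosed K]
    (hsurj : Function.Surjective (expU : K → Kˣ)) (hker : {x : K | expU x = 1}.Infinite)
    (hEC : IsExistentiallyClosed K) {f : ℕ → ExpPoly K} {n : ℕ}
    (hM : FiniteZerosSplit f n) (hf : IsTower f (n + 1)) {P : MvPolynomial (Fin (n + 2)) K}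
    (hdeg : (lastEquiv K (n + 1) P).natDegree ≠ 0) (h0 : (lastEquiv K (n + 1) P).coeff 0 ≠ 0) :
    {a : K | aeval (fun j : Fin (n + 2) => valuesAt f a j) P = 0}.Infinite := by
  obtain ⟨E, _, _, y, _, hy⟩ := exists_isAlgClosed_isTranscendenceBasis K (n + 1)
  -- a generic zero of `P`: the last coordinate is algebraic over the others, and nonzero
  have hinj : Function.Injective (aeval y : MvPolynomial (Fin (n + 1)) K →ₐ[K] E).toRingHom :=
    hy.1
  obtain ⟨t, ht⟩ := IsAlgClosed.exists_root
    ((lastEquiv K (n + 1) P).map (aeval y : MvPolynomial (Fin (n + 1)) K →ₐ[K] E).toRingHom) (by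
      rw [Polynomial.degree_map_eq_of_injective hinj]
      exact fun h => hdeg (Polynomial.natDegree_eq_of_degree_eq_some h))
  rw [Polynomial.IsRoot, Polynomial.eval_map] at ht
  have ht0 : t ≠ 0 := by
    rintro rfl
    rw [Polynomial.eval₂_at_zero] at ht
    exact h0 (hinj (ht.trans (map_zero _).symm))
  let z : Fin (n + 2) → E := Fin.snoc y t
  have hzc : (fun i : Fin (n + 1) => z i.castSucc) = y := funext fun i => Fin.snoc_castSucc _ _ _
  have hzl : z (Fin.last (n + 1)) = t := Fin.snoc_last _ _
  have hP : aeval z P = 0 := by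
    rw [aeval_eq_eval₂_lastEquiv, hzc, hzl, ht]
  have hv0 (j : Fin (n + 1)) : z j.succ ≠ 0 := by
    refine Fin.lastCases ?_ (fun i => ?_) j
    · rw [Fin.succ_last, hzl]
      exact ht0
    · rw [Fin.succ_castSucc]
      exact (congrFun hzc i.succ).trans_ne (hy.1.ne_zero _)
  have hz : IsTranscendenceBasis K fun i : Fin (n + 1) => z i.castSucc := hzc ▸ hy
  by_cases hrel : ∀ m : Fin (n + 1) → ℤ, m ≠ 0 → ∀ b : K,
      ((∏ i, Units.mk0 (z i.succ) (hv0 i) ^ m i : Eˣ) : E) ≠ algebraMap K E b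
  · exact hf.infinite_zeros_of_forall_ne hEC hz hv0 hP hrel
  · push Not at hrel
    obtain ⟨m, hm, b, hb⟩ := hrel
    exact hf.infinite_zeros_of_prod_eq hsurj hker hM hz hv0 hP hm hb

/-- A polynomial in `x` and the exponentials of a tower that has finitely many zeros is split. -/
theorem IsTower.finiteZerosSplit [IsAlgClosed K]
    (hsurj : Function.Surjective (expU : K → Kˣ)) (hker : {x : K | expU x = 1}.Infinite)
    (hEC : IsExistentiallyClosed K) {f : ℕ → ExpPoly K} {n : ℕ} (hf : IsTower f n) :
    FiniteZerosSplit f n := by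
  induction n with
  | zero =>
    intro P _ _
    refine ⟨aeval (fun _ => Polynomial.X) P, 0, ?_⟩
    rw [comp_aeval_apply]
    have : (fun _ : Fin (0 + 1) => Polynomial.aeval (X 0 : MvPolynomial (Fin (0 + 1)) K)
        (Polynomial.X : Polynomial K)) = X := by
      ext1 i
      rw [Polynomial.aeval_X, Fin.fin_one_eq_zero i]
    rw [this]
    simp
  | succ n ih =>
    intro P hP hfin
    have hM := ih (hf.of_le n.le_succ)
    have hP' : lastEquiv K (n + 1) P ≠ 0 := (map_ne_zero_iff _ (lastEquiv K (n + 1)).injective).2 hP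
    -- divide `P` by the largest possible power of the last variable
    obtain ⟨q, hq, hqdvd⟩ := Polynomial.exists_eq_pow_rootMultiplicity_mul_and_not_dvd
      (lastEquiv K (n + 1) P) hP' 0
    set k := (lastEquiv K (n + 1) P).rootMultiplicity 0
    rw [Polynomial.C_0, sub_zero] at hq hqdvd
    rw [Polynomial.X_dvd_iff] at hqdvd
    obtain ⟨Q, rfl⟩ := (lastEquiv K (n + 1)).surjective q
    have hPQ : P = X (Fin.last (n + 1)) ^ k * Q := by
      apply (lastEquiv K (n + 1)).injective
      rw [hq, map_mul, map_pow, lastEquiv_X_last]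
    have hzero (a : K) : aeval (fun j : Fin (n + 2) => valuesAt f a j) P = 0 ↔
        aeval (fun j : Fin (n + 2) => valuesAt f a j) Q = 0 := by
      rw [hPQ, map_mul, map_pow, aeval_X, mul_eq_zero, or_iff_right]
      exact pow_ne_zero _ (valuesAt_succ_ne_zero f a n)
    simp only [hzero] at hfin
    have hdeg : (lastEquiv K (n + 1) Q).natDegree = 0 := by
      by_contra hd
      exact hf.infinite_zeros hsurj hker hEC hM hd hqdvd hfin
    obtain ⟨Q₀, hQ₀⟩ : ∃ Q₀, lastEquiv K (n + 1) Q = Polynomial.C Q₀ :=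
      ⟨_, Polynomial.eq_C_of_natDegree_eq_zero hdeg⟩
    have hQ₀ne : Q₀ ≠ 0 := by
      rintro rfl
      rw [hQ₀] at hqdvd
      simp at hqdvd
    obtain ⟨R, e, hRe⟩ := hM Q₀ hQ₀ne (by
      refine hfin.subset fun a ha => ?_
      rw [Set.mem_ofPred_eq, aeval_eq_eval₂_lastEquiv, hQ₀, Polynomial.eval₂_C]
      exact ha)
    refine ⟨R, Fin.snoc e k, ?_⟩
    rw [hPQ, Fin.prod_univ_castSucc, Fin.snoc_last, Fin.succ_last, mul_comm, ← mul_assoc]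
    congr 1
    apply (lastEquiv K (n + 1)).injective
    rw [hQ₀, hRe, map_mul, map_prod, map_mul, map_prod]
    congr 1
    · have h1 : lastEquiv K (n + 1) (X 0) = Polynomial.C (X 0) := lastEquiv_X_castSucc 0
      have h2 := Polynomial.aeval_algHom_apply (lastEquiv K (n + 1)) (X 0) R
      rw [h1] at h2
      exact (Polynomial.aeval_algHom_apply (Polynomial.CAlgHom (R := K)) (X 0) R).symm.trans h2
    · refine Finset.prod_congr rfl fun i _ => ?_
      rw [Fin.snoc_castSucc, Fin.succ_castSucc, map_pow, map_pow, lastEquiv_X_castSucc]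

end Zeros

/-- A polynomial over an algebraically closed field in terms of its distinct roots. -/
theorem eq_C_mul_prod_roots {K : Type*} [Field K] [IsAlgClosed K] [DecidableEq K]
    (R : Polynomial K) :
    R = Polynomial.C R.leadingCoeff *
      ∏ a ∈ R.roots.toFinset, (Polynomial.X - Polynomial.C a) ^ R.roots.count a := by
  conv_lhs => rw [(IsAlgClosed.splits R).eq_prod_roots]
  rw [Finset.prod_multiset_map_count]

end ZilberExp

end

open ZilberExp in
/-- Let `K` be an algebraically closed field of characteristic zero with a surjective exponential
map `K → K^*` with infinite kernel that satisfies the existential closedness axiom, such as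
Zilber's pseudoexponentiation. If the exponential polynomial `p` over `K` has exactly `m > 0`
zeros in `K`, then `p = (x - a₁) ^ n₁ ⋯ (x - aₘ) ^ nₘ * exp g`. -/
theorem mainTheorem3 {K : Type*} [Field K] [CharZero K] [IsAlgClosed K] [ZilberExp.ERing K]
    (hsurj : Function.Surjective (ZilberExp.expU : K → Kˣ))
    (hker : {x : K | ZilberExp.expU x = 1}.Infinite)
    (hEC : ZilberExp.IsExistentiallyClosed K)
    (p : ZilberExp.ExpPoly K) (m : ℕ) (hm : 0 < m)
    (hp : {x : K | ZilberExp.ExpPoly.eval x p = 0}.encard = m) :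
    ∃ (a : Fin m → K) (n : Fin m → ℕ) (g : ZilberExp.ExpPoly K),
      p = (∏ i, (ZilberExp.ExpPoly.X K - ZilberExp.ExpPoly.C K (a i)) ^ n i) *
        (ZilberExp.expU g : (ZilberExp.ExpPoly K)ˣ) := by
  classical
  obtain ⟨f, n, hf, P, Q, hQ, hPQ⟩ := exists_isTower_mem_level p
  have hM := hf.finiteZerosSplit hsurj hker hEC
  -- the denominator has no zeros, so it is a constant times a monomial in the exponentials
  have hQa (a : K) : MvPolynomial.aeval (fun j : Fin (n + 1) => valuesAt f a j) Q ≠ 0 := by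
    rw [← eval_aeval_expVars]
    exact (hQ.map (ExpPoly.eval a)).ne_zero
  obtain ⟨κ, e', hκ, hQe⟩ := hM.exists_of_forall_ne_zero hQa
  have hzero (a : K) : MvPolynomial.aeval (fun j : Fin (n + 1) => valuesAt f a j) P = 0 ↔
      ExpPoly.eval a p = 0 := by
    have h1 := congrArg (ExpPoly.eval a) hPQ
    rw [map_mul, eval_aeval_expVars, eval_aeval_expVars] at h1
    rw [← h1, mul_eq_zero, or_iff_right (hQa a)]
  have hfin : {x : K | ExpPoly.eval x p = 0}.Finite := Set.finite_of_encard_eq_coe hp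
  have hP : P ≠ 0 := by
    rintro rfl
    refine Set.infinite_univ (α := K) (hfin.subset fun a _ => ?_)
    exact (hzero a).1 (map_zero _)
  obtain ⟨R, e, hPe⟩ := hM P hP (by simpa only [hzero] using hfin)
  have hR0 : R ≠ 0 := by
    rintro rfl
    rw [map_zero, zero_mul] at hPe
    exact hP hPe
  have hRz (a : K) : R.eval a = 0 ↔ ExpPoly.eval a p = 0 := by
    rw [← hzero, hPe, aeval_valuesAt_split_eq_zero_iff]
  have hcard : R.roots.toFinset.card = m := by
    have h1 : {x : K | ExpPoly.eval x p = 0} = R.roots.toFinset := by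
      ext a
      rw [Set.mem_ofPred_eq, ← hRz, Finset.mem_coe, Multiset.mem_toFinset,
        Polynomial.mem_roots hR0, Polynomial.IsRoot]
    rw [h1, Set.encard_coe_eq_coe_finsetCard] at hp
    exact_mod_cast hp
  let σ := (Finset.equivFinOfCardEq hcard).symm
  have hlead : R.leadingCoeff ≠ 0 := Polynomial.leadingCoeff_ne_zero.2 hR0
  obtain ⟨d, hd⟩ := hsurj (Units.mk0 (R.leadingCoeff / κ) (div_ne_zero hlead hκ))
  refine ⟨fun i => σ i, fun i => R.roots.count (σ i : K),
    algebraMap K _ d + (∑ i : Fin n, e i • f i - ∑ i : Fin n, e' i • f i), ?_⟩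
  refine hQ.mul_left_cancel ?_
  have hRX : Polynomial.aeval (ExpPoly.X K) R = algebraMap K (ExpPoly K) R.leadingCoeff *
      ∏ i, (ExpPoly.X K - ExpPoly.C K (σ i)) ^ R.roots.count (σ i : K) := by
    conv_lhs => rw [eq_C_mul_prod_roots R]
    rw [map_mul, Polynomial.aeval_C, map_prod, ← Finset.prod_coe_sort]
    congr 1
    refine (Fintype.prod_equiv σ _ _ fun i => ?_).symm
    rw [map_pow, map_sub, Polynomial.aeval_X, Polynomial.aeval_C]
    rfl
  have hvars (e : Fin n → ℕ) : MvPolynomial.aeval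
      (fun j : Fin (n + 1) => expVars (ExpPoly.X K) f j)
      (∏ i : Fin n, MvPolynomial.X i.succ ^ e i : MvPolynomial (Fin (n + 1)) K) =
      ((expU (∑ i : Fin n, e i • f i) : (ExpPoly K)ˣ) : ExpPoly K) := by
    rw [map_prod, expU_sum, Units.coe_prod]
    refine Finset.prod_congr rfl fun i _ => ?_
    rw [map_pow, MvPolynomial.aeval_X, expU_nsmul]
    rfl
  have hPz : MvPolynomial.aeval (fun j : Fin (n + 1) => expVars (ExpPoly.X K) f j) P =
      Polynomial.aeval (ExpPoly.X K) R * (expU (∑ i : Fin n, e i • f i) : (ExpPoly K)ˣ) := by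
    rw [hPe, map_mul, hvars, ← Polynomial.aeval_algHom_apply, MvPolynomial.aeval_X]
    rfl
  have hQz : MvPolynomial.aeval (fun j : Fin (n + 1) => expVars (ExpPoly.X K) f j) Q =
      algebraMap K _ κ * (expU (∑ i : Fin n, e' i • f i) : (ExpPoly K)ˣ) := by
    rw [hQe, map_mul, hvars, MvPolynomial.aeval_C]
  have hd' : algebraMap K (ExpPoly K) κ * (expU (algebraMap K (ExpPoly K) d) : (ExpPoly K)ˣ) =
      algebraMap K (ExpPoly K) R.leadingCoeff := by
    rw [ExpPoly.expU_algebraMap, hd, Units.val_mk0, ← map_mul, mul_div_cancel₀ _ hκ]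
  rw [hPQ, hPz, hRX, hQz, ← hd', expU_add, expU_sub, Units.val_mul]
  have hcancel : ((expU (∑ i : Fin n, e' i • f i) : (ExpPoly K)ˣ) : ExpPoly K) *
      ((expU (∑ i : Fin n, e i • f i) / expU (∑ i : Fin n, e' i • f i) : (ExpPoly K)ˣ) :
        ExpPoly K) = (expU (∑ i : Fin n, e i • f i) : (ExpPoly K)ˣ) := by
    rw [← Units.val_mul, mul_div_cancel]
  rw [← hcancel]
  ring
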